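/- **Definitions.** Let $\varphi$ be Euler's totient function and $\nu_p$ the $p$-adic valuation. For a prime $p$, every integer $n\ge 0$ can be written uniquely as $n=a_0+\sum_{i\ge 1}a_i\varphi(p^i)$ with $a_0\in\{0,\dots,p-2\}$ and $a_i\in\{0,\dots,p-1\}$ for $i\ge 1$. Define polynomials in $\mathbb{Q}[X]$ by $e^{(p)}_0=X$, $$e^{(2)}_1=\tfrac{X+1}{2},\qquad e^{(p)}_1=\frac1{p!}\prod_{a=1}^{(p-1)/2}(X^2-a^2)\ (p\ne 2),\qquad e^{(p)}_j=\frac{1}{(p^j)!}\prod_{\substack{0\le a\le\lfloor p^j/2\rfloor\\ (a,p)=1}}(X^2-a^2)\ (j\ge 2),$$ and $E^{(p)}_n=\prod_{j\ge 0}(e^{(p)}_j)^{a_j}$, where the $a_j$ are the digits of $n$ above. For $k\ge 0$ let $C_p(k)=\prod_{i\ge0}(p^i!)^{a_i}$, where the $a_i$ are the digits of $2k$, and let the integers $c^{(k,p)}_{2i}$ $(0\le i<k)$ be given by $$C_p(k)\,E^{(p)}_{2k}(X)=X^{2k}-\sum_{i=0}^{k-1}c^{(k,p)}_{2i}X^{2i}.$$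 Let $m\ge 1$ be an integer. For $k\ge 1$ let $S_k$ be the set of primes $p$ with $p-1\le 2k$, and $M_k=\prod_{p\in S_k}p^{\nu_p(C_p(k))}$. The integer matrix $\Phi^{(m)}=(\Phi^{(m)}_{i,j})_{i,j\ge 0}$ is defined recursively by rows: $\Phi^{(m)}_{0,0}=1$ and $\Phi^{(m)}_{0,j}=0$ for $j>0$; $\Phi^{(m)}_{i,j}=0$ for all odd $i$; and, for $k\ge 1$, $\Phi^{(m)}_{2k,j}=0$ for $j>k$, $\Phi^{(m)}_{2k,k}=M_k$, and for $0\le j<k$ the entry $\Phi^{(m)}_{2k,j}$ is the unique integer with $0\le \Phi^{(m)}_{2k,j}<M_k$ and $$(1-p^{2(k+m)-1})\,\Phi^{(m)}_{2k,j}\equiv\sum_{i=0}^{k-1}c^{(k,p)}_{2i}\,(1-p^{2(i+m)-1})\,\Phi^{(m)}_{2i,j}\pmod{p^{\nu_p(C_p(k))}}\quad\text{for all }p\in S_k.$$ A $\mathbb{Z}_p$-valued measure on the profinite group $\mathbb{Z}_p^*/\{\pm1\}$ is a $\mathbb{Z}_p$-linear map $\mu:\mathrm{C}(\mathbb{Z}_p^*/\{\pm1\},\mathbb{Z}_p)\to\mathbb{Z}_p$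 on the continuous functions; write $\int f\,d\mu=\mu(f)$. Let $\mathrm{Mom}^{\mathrm{Euler}}_{\ge 2m}$ be the set of integer sequences $(b_k)_{k\ge 2m}$ such that $b_k=0$ for all odd $k$ and such that for every prime $p$ there is a $\mathbb{Z}_p$-valued measure $\mu$ on $\mathbb{Z}_p^*/\{\pm1\}$ with $$(1-p^{2k-1})\,b_{2k}=\int_{\mathbb{Z}_p^*/\{\pm1\}}x^{2k}\,d\mu(x)\qquad\text{for all }k\ge m.$$ It is a group under termwise addition. **Theorem.** For every integer $m\ge1$, the map $$\Phi_m:\mathbb{Z}^{\mathbb{N}_0}\to\mathrm{Mom}^{\mathrm{Euler}}_{\ge 2m},\qquad (l_j)_{j\ge0}\mapsto\Big(\sum_{j\ge0}\Phi^{(m)}_{k-2m,j}\,l_j\Big)_{k\ge2m},$$ is well defined (the sums are finite and the image lies in $\mathrm{Mom}^{\mathrm{Euler}}_{\ge 2m}$) and is an isomorphism of groups. -/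

import Mathlib

namespace EulerMoments

open Polynomial

/-! ### Expansions to the base `p` with place values `1, φ(p), φ(p ^ 2), …` -/

/-- The digit `a_i` in `n = a_0 + ∑_{i ≥ 1} a_i φ(p ^ i)`, where `0 ≤ a_0 ≤ p - 2` and
`0 ≤ a_i ≤ p - 1` for `i ≥ 1`. -/
def phiDigit (p n : ℕ) : ℕ → ℕ
  | 0 => n % (p - 1)
  | i + 1 => n / (p - 1) / p ^ i % p

theorem phiDigit_zero_lt {p : ℕ} (hp : p.Prime) (n : ℕ) : phiDigit p n 0 < p - 1 :=
  Nat.mod_lt _ (Nat.sub_pos_of_lt hp.one_lt)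

theorem phiDigit_succ_lt {p : ℕ} (hp : p.Prime) (n i : ℕ) : phiDigit p n (i + 1) < p :=
  Nat.mod_lt _ hp.pos

/-- All digits beyond the `n`-th one vanish. -/
theorem phiDigit_eq_zero {p : ℕ} (hp : p.Prime) {n i : ℕ} (h : n < i) : phiDigit p n i = 0 := by
  obtain ⟨i, rfl⟩ : ∃ j, i = j + 1 := ⟨i - 1, by omega⟩
  have h1 : n / (p - 1) < p ^ i :=
    lt_of_le_of_lt ((Nat.div_le_self _ _).trans (Nat.lt_succ_iff.mp h)) (Nat.lt_pow_self hp.one_lt)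
  simp [phiDigit, Nat.div_eq_of_lt h1]

/-- The expansion with place values `1, φ(p), φ(p ^ 2), …`. -/
theorem phiDigit_expansion {p : ℕ} (hp : p.Prime) (n : ℕ) :
    n = phiDigit p n 0 + ∑ i ∈ Finset.range n, phiDigit p n (i + 1) * (p ^ (i + 1)).totient := by
  have key : ∀ q N : ℕ, q = (∑ i ∈ Finset.range N, q / p ^ i % p * p ^ i) + p ^ N * (q / p ^ N) := by
    intro q N
    induction N with
    | zero => simp
    | succ N ih =>
      rw [Finset.sum_range_succ]
      have h2 := Nat.mod_add_div (q / p ^ N) p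
      rw [Nat.div_div_eq_div_mul, ← pow_succ] at h2
      conv_lhs => rw [ih, ← h2]
      ring
  have h1 : n / (p - 1) / p ^ n = 0 :=
    Nat.div_eq_of_lt (lt_of_le_of_lt (Nat.div_le_self _ _) (Nat.lt_pow_self hp.one_lt))
  have h3 := key (n / (p - 1)) n
  rw [h1, mul_zero, add_zero] at h3
  have h4 : ∑ i ∈ Finset.range n, phiDigit p n (i + 1) * (p ^ (i + 1)).totient
      = (p - 1) * (n / (p - 1)) := by
    conv_rhs => rw [h3]
    rw [Finset.mul_sum]
    refine Finset.sum_congr rfl fun i _ => ?_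
    rw [Nat.totient_prime_pow_succ hp]
    simp only [phiDigit]
    ring
  rw [h4]
  exact (Nat.mod_add_div n (p - 1)).symm

/-! ### The polynomials -/

/-- The polynomials `e_j`. -/
noncomputable def digitPoly (p : ℕ) : ℕ → ℚ[X]
  | 0 => X
  | 1 =>
    if p = 2 then C (1 / 2) * (X + 1)
    else C (1 / (p.factorial : ℚ)) * ∏ a ∈ Finset.Icc 1 ((p - 1) / 2), (X ^ 2 - C ((a : ℚ) ^ 2))
  | j + 2 =>
    C (1 / ((p ^ (j + 2)).factorial : ℚ)) *
      ∏ a ∈ Finset.Icc 0 (p ^ (j + 2) / 2) with a.Coprime p, (X ^ 2 - C ((a : ℚ) ^ 2))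

/-- The polynomial `E_n = ∏_j e_j ^ a_j`, where the `a_j` are the digits of `n`; the digits `a_j`
with `j > n` vanish. -/
noncomputable def basisPoly (p n : ℕ) : ℚ[X] :=
  ∏ j ∈ Finset.range (n + 1), digitPoly p j ^ phiDigit p n j

/-- The number `C_p(k) = ∏_i (p ^ i)! ^ a_i`, where the `a_i` are the digits of `2 * k`; it is the
inverse of the leading coefficient of `E_{2k}`. -/
def leadDenom (p k : ℕ) : ℕ :=
  ∏ i ∈ Finset.range (2 * k + 1), (p ^ i).factorial ^ phiDigit p (2 * k) i

/-- The integers `c_{2i}` with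
`C_p(k) * E_{2k}(X) = X ^ (2 * k) - ∑_{i < k} c_{2i} * X ^ (2 * i)`: minus the coefficient of
`X ^ (2 * i)` on the left (an integer by `coe_recCoeff`). -/
noncomputable def recCoeff (p k i : ℕ) : ℤ :=
  (-(C (leadDenom p k : ℚ) * basisPoly p (2 * k)).coeff (2 * i)).num

theorem digitPoly_integral (p j : ℕ) :
    ∃ P : ℤ[X], C ((p ^ j).factorial : ℚ) * digitPoly p j = P.map (Int.castRingHom ℚ) := by
  have aux : ∀ (N : ℕ) (s : Finset ℕ), ∃ P : ℤ[X], C (N.factorial : ℚ) *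
      (C (1 / (N.factorial : ℚ)) * ∏ a ∈ s, (X ^ 2 - C ((a : ℚ) ^ 2)))
        = P.map (Int.castRingHom ℚ) := by
    intro N s
    refine ⟨∏ a ∈ s, (X ^ 2 - C ((a : ℤ) ^ 2)), ?_⟩
    have h : (N.factorial : ℚ) ≠ 0 := by exact_mod_cast N.factorial_ne_zero
    rw [← mul_assoc, ← C_mul, mul_one_div_cancel h, C_1, one_mul, Polynomial.map_prod]
    refine Finset.prod_congr rfl fun a _ => ?_
    simp
  match j with
  | 0 => exact ⟨X, by simp [digitPoly]⟩
  | 1 =>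
    by_cases hp : p = 2
    · refine ⟨X + 1, ?_⟩
      subst hp
      simp only [digitPoly, if_true]
      rw [← mul_assoc, ← C_mul]
      norm_num [Nat.factorial]
    · simp only [digitPoly, if_neg hp, pow_one]
      exact aux _ _
  | j + 2 => exact aux _ _

theorem coe_recCoeff (p k i : ℕ) :
    (recCoeff p k i : ℚ) = -(C (leadDenom p k : ℚ) * basisPoly p (2 * k)).coeff (2 * i) := by
  choose P hP using digitPoly_integral p
  have h : C (leadDenom p k : ℚ) * basisPoly p (2 * k)
      = (∏ j ∈ Finset.range (2 * k + 1), P j ^ phiDigit p (2 * k) j).map (Int.castRingHom ℚ) := by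
    rw [Polynomial.map_prod, leadDenom, basisPoly, Nat.cast_prod, map_prod, ← Finset.prod_mul_distrib]
    refine Finset.prod_congr rfl fun j _ => ?_
    rw [Polynomial.map_pow, ← hP, mul_pow, Nat.cast_pow, map_pow]
  rw [recCoeff, h, coeff_map, eq_intCast, ← Int.cast_neg, Rat.num_intCast]

/-! ### The matrix -/

/-- The primes `p` with `p - 1 ≤ 2 * k`. -/
def primeSet (k : ℕ) : Finset ℕ := {p ∈ Finset.range (2 * k + 2) | p.Prime}

/-- The prime power `p ^ ν_p(C_p(k))`. -/
def localModulus (p k : ℕ) : ℕ := p ^ padicValNat p (leadDenom p k)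

/-- The product of the `p ^ ν_p(C_p(k))` over the primes `p` with `p - 1 ≤ 2 * k`. -/
def modulus (k : ℕ) : ℕ := ∏ p ∈ primeSet k, localModulus p k

/-- The system of congruences that determines the matrix entries has a unique solution in
`[0, modulus k)`, whatever the right-hand sides are. -/
theorem existsUnique_entry (m : ℕ) {k : ℕ} (hk : k ≠ 0) (R : ℕ → ℤ) :
    ∃! x : ℤ, 0 ≤ x ∧ x < modulus k ∧ ∀ p ∈ primeSet k,
      (1 - (p : ℤ) ^ (2 * (k + m) - 1)) * x ≡ R p [ZMOD localModulus p k] := by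
  have hprime : ∀ p ∈ primeSet k, p.Prime := fun p hp => (Finset.mem_filter.mp hp).2
  have hpair : Set.Pairwise (primeSet k : Set ℕ)
      (Function.onFun Nat.Coprime fun p => localModulus p k) := by
    intro p hp q hq hpq
    exact Nat.Coprime.pow _ _ ((Nat.coprime_primes (hprime p hp) (hprime q hq)).mpr hpq)
  have hlocpos : ∀ p ∈ primeSet k, localModulus p k ≠ 0 := fun p hp =>
    pow_ne_zero _ (hprime p hp).ne_zero
  have hpos : 0 < modulus k := Finset.prod_pos fun p hp => Nat.pos_of_ne_zero (hlocpos p hp)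
  have hcop : ∀ p ∈ primeSet k,
      IsCoprime (1 - (p : ℤ) ^ (2 * (k + m) - 1)) (localModulus p k : ℤ) := by
    intro p _
    rw [localModulus, Nat.cast_pow]
    refine IsCoprime.pow_right ⟨1, (p : ℤ) ^ (2 * (k + m) - 2), ?_⟩
    have h1 : 2 * (k + m) - 1 = (2 * (k + m) - 2) + 1 := by omega
    rw [h1, pow_succ]
    ring
  have hsol : ∀ p : ℕ, ∃ y : ℕ, p ∈ primeSet k →
      (1 - (p : ℤ) ^ (2 * (k + m) - 1)) * y ≡ R p [ZMOD localModulus p k] := by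
    intro p
    by_cases hp : p ∈ primeSet k
    · obtain ⟨u, v, huv⟩ := hcop p hp
      have hne : (localModulus p k : ℤ) ≠ 0 := by exact_mod_cast hlocpos p hp
      refine ⟨((u * R p) % (localModulus p k : ℤ)).toNat, fun _ => ?_⟩
      rw [Int.toNat_of_nonneg (Int.emod_nonneg _ hne)]
      refine ((Int.mod_modEq (u * R p) _).mul_left _).trans ?_
      refine (Int.modEq_iff_dvd.mpr ⟨v * R p, ?_⟩)
      linear_combination (-R p) * huv
    · exact ⟨0, fun h => absurd h hp⟩
  choose y hy using hsol
  set z := Nat.chineseRemainderOfFinset y (fun p => localModulus p k) (primeSet k) hlocpos hpair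
    with hz
  refine ⟨((z : ℕ) : ℤ) % modulus k, ⟨Int.emod_nonneg _ (by exact_mod_cast hpos.ne'),
    Int.emod_lt_of_pos _ (by exact_mod_cast hpos), fun p hp => ?_⟩, ?_⟩
  · have h1 : ((z : ℕ) : ℤ) % modulus k ≡ (z : ℕ) [ZMOD localModulus p k] :=
      (Int.mod_modEq _ _).of_dvd (by exact_mod_cast Finset.dvd_prod_of_mem _ hp)
    have h2 : ((z : ℕ) : ℤ) ≡ y p [ZMOD localModulus p k] :=
      (Int.natCast_modEq_iff).mpr (z.2 p hp)
    exact ((h1.trans h2).mul_left _).trans (hy p hp)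
  · rintro x ⟨hx0, hx1, hx⟩
    have h1 : (modulus k : ℤ) ∣ (z : ℕ) - x := by
      rw [modulus, Nat.cast_prod]
      refine Finset.prod_dvd_of_coprime (fun p hp q hq hpq => ?_) fun p hp => ?_
      · exact Nat.Coprime.isCoprime (hpair hp hq hpq)
      · have h2 : ((z : ℕ) : ℤ) ≡ y p [ZMOD localModulus p k] :=
          (Int.natCast_modEq_iff).mpr (z.2 p hp)
        have h3 := ((h2.mul_left (1 - (p : ℤ) ^ (2 * (k + m) - 1))).trans (hy p hp)).trans
          (hx p hp).symm
        have h4 := h3.symm.dvd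
        rw [← mul_sub] at h4
        exact (hcop p hp).symm.dvd_of_dvd_mul_left h4
    have h5 : x % modulus k = (z : ℕ) % modulus k := Int.modEq_iff_dvd.mpr h1
    rw [← h5, Int.emod_eq_of_lt hx0 hx1]

/-- The entry in row `2 * k` and column `j` of the matrix, by recursion over `k`. -/
noncomputable def evenEntry (m k j : ℕ) : ℤ :=
  if hk : k = 0 then (if j = 0 then 1 else 0)
  else if j < k then
    (existsUnique_entry m hk fun p =>
      ∑ i : Fin k, recCoeff p k i * (1 - (p : ℤ) ^ (2 * (i + m) - 1)) * evenEntry m i j).exists.choose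
  else if j = k then (modulus k : ℤ)
  else 0
termination_by k

/-- The matrix; its rows with odd index vanish. -/
noncomputable def momentMatrix (m i j : ℕ) : ℤ :=
  if Even i then evenEntry m (i / 2) j else 0

/-- The entries below the diagonal satisfy the bounds and the congruences that determine them. -/
theorem evenEntry_spec (m : ℕ) {k j : ℕ} (hj : j < k) :
    0 ≤ evenEntry m k j ∧ evenEntry m k j < modulus k ∧ ∀ p ∈ primeSet k,
      (1 - (p : ℤ) ^ (2 * (k + m) - 1)) * evenEntry m k j ≡
        ∑ i : Fin k, recCoeff p k i * (1 - (p : ℤ) ^ (2 * (i + m) - 1)) * evenEntry m i j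
          [ZMOD localModulus p k] := by
  have hk : k ≠ 0 := by omega
  have h := (existsUnique_entry m hk fun p => ∑ i : Fin k,
    recCoeff p k i * (1 - (p : ℤ) ^ (2 * (i + m) - 1)) * evenEntry m i j).exists.choose_spec
  have e : evenEntry m k j = (existsUnique_entry m hk fun p => ∑ i : Fin k,
      recCoeff p k i * (1 - (p : ℤ) ^ (2 * (i + m) - 1)) * evenEntry m i j).exists.choose := by
    rw [evenEntry, dif_neg hk, if_pos hj]
  rw [← e] at h
  exact h

theorem momentMatrix_eq_zero (m : ℕ) {i j : ℕ} (h : i < 2 * j) : momentMatrix m i j = 0 := by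
  rw [momentMatrix]
  split_ifs with hi
  · obtain ⟨r, rfl⟩ := hi
    rw [evenEntry]
    split_ifs <;> first | rfl | omega
  · rfl

/-- The linear map given by the matrix: `(l_j)` is sent to the sequence with `k`-th term
`∑_{j ≥ 0} momentMatrix m (k - 2 * m) j * l_j`, for `k ≥ 2 * m`. The terms with `j > k - 2 * m`
vanish by `momentMatrix_eq_zero`. -/
noncomputable def momentMap (m : ℕ) (l : ℕ → ℤ) : {k : ℕ // 2 * m ≤ k} → ℤ :=
  fun k => ∑ j ∈ Finset.range (k - 2 * m + 1), momentMatrix m (k - 2 * m) j * l j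

/-! ### Measures and moments -/

/-- The profinite group `ℤ_pˣ / {±1}`. -/
abbrev UnitsModSign (p : ℕ) [Fact p.Prime] : Type :=
  ℤ_[p]ˣ ⧸ Subgroup.zpowers (-1 : ℤ_[p]ˣ)

/-- A `ℤ_p`-valued measure on `ℤ_pˣ / {±1}`: a `ℤ_p`-linear functional on the continuous
functions (it is automatically continuous). -/
abbrev Meas (p : ℕ) [Fact p.Prime] : Type :=
  C(UnitsModSign p, ℤ_[p]) →ₗ[ℤ_[p]] ℤ_[p]

/-- The function `x ↦ x ^ (2 * k)` on `ℤ_pˣ / {±1}`. -/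
noncomputable def evenPow (p : ℕ) [Fact p.Prime] (k : ℕ) : C(UnitsModSign p, ℤ_[p]) where
  toFun x := ((QuotientGroup.lift (Subgroup.zpowers (-1 : ℤ_[p]ˣ)) (powMonoidHom (2 * k))
    (by
      rw [Subgroup.zpowers_le, MonoidHom.mem_ker, powMonoidHom_apply, pow_mul]
      simp) x : ℤ_[p]ˣ) : ℤ_[p])
  continuous_toFun := by
    refine Units.continuous_val.comp ?_
    exact Continuous.quotient_lift (continuous_pow (2 * k)) _

theorem evenPow_mk (p : ℕ) [Fact p.Prime] (k : ℕ) (u : ℤ_[p]ˣ) :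
    evenPow p k (u : UnitsModSign p) = (u : ℤ_[p]) ^ (2 * k) := by
  simp [evenPow]

/-- The group of integer sequences `(b_k)_{k ≥ 2m}` with `b_k = 0` for all odd `k`, such that for
every prime `p` there is a `ℤ_p`-valued measure on `ℤ_pˣ / {±1}` whose `2k`-th moment is
`(1 - p ^ (2k - 1)) * b_{2k}` for all `k ≥ m`. -/
def MomEuler (m : ℕ) : AddSubgroup ({k : ℕ // 2 * m ≤ k} → ℤ) where
  carrier := {b | (∀ k : {k : ℕ // 2 * m ≤ k}, Odd (k : ℕ) → b k = 0) ∧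
    ∀ (p : ℕ) [Fact p.Prime], ∃ μ : Meas p, ∀ (k : ℕ) (hk : m ≤ k),
      (((1 - (p : ℤ) ^ (2 * k - 1)) * b ⟨2 * k, Nat.mul_le_mul_left 2 hk⟩ : ℤ) : ℤ_[p])
        = μ (evenPow p k)}
  zero_mem' := ⟨fun _ _ => rfl, fun p _ => ⟨0, fun k hk => by simp⟩⟩
  add_mem' := by
    rintro a b ⟨ha, ha'⟩ ⟨hb, hb'⟩
    refine ⟨fun k hk => by simp [ha k hk, hb k hk], fun p _ => ?_⟩
    obtain ⟨μ, hμ⟩ := ha' p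
    obtain ⟨ν, hν⟩ := hb' p
    refine ⟨μ + ν, fun k hk => ?_⟩
    rw [LinearMap.add_apply, ← hμ k hk, ← hν k hk, Pi.add_apply, mul_add, Int.cast_add]
  neg_mem' := by
    rintro a ⟨ha, ha'⟩
    refine ⟨fun k hk => by simp [ha k hk], fun p _ => ?_⟩
    obtain ⟨μ, hμ⟩ := ha' p
    refine ⟨-μ, fun k hk => ?_⟩
    rw [LinearMap.neg_apply, ← hμ k hk, Pi.neg_apply, mul_neg, Int.cast_neg]

end EulerMoments

namespace EulerMoments

open Polynomial

/-! Fix `p` and put `e k = (1 - p^(2(k+m)-1)) * b (2(k+m))`. The numbers `e k` are the moments of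
`x^(2(k+m))` for some measure if and only if `localModulus p k` divides `e k - ∑_{i<k} c_{2i} e i`
for all `k` (`mem_MomEuler_iff`).

Necessity: `C_p(k) * E_{2k}` is divisible by this power of `p` on all `p`-adic units, so the
integral of its product with `x^(2m)` is divisible too.

Sufficiency: modulo `p` the functions `basisVal p n` are linearly independent
(`basisVal_linearIndependent`). The reason is that the normalised `e_j` separates the `p` lifts of a
unit class from modulo `p^j` to modulo `p^(j+1)`. By duality and Nakayama, finitely many integrals
of the `basisVal p (2k)` can be prescribed by combinations of Dirac measures; compactness handles
all `k` at once.

These congruences, over all `p`, form a triangular system. The columns of the matrix solve it, with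
`M_k` on the diagonal. Since `1 - p^(2(k+m)-1)` is prime to `p` for `k ≥ 1`, two solutions that
agree before `k` differ at `k` by a multiple of `M_k`. Hence every solution is a unique, possibly
infinite, integral combination of the columns. -/

/-! ### Reduced residue systems -/

/-- The finite set `R` contains exactly one representative of every unit class modulo `p ^ j`, and
nothing else. -/
structure IsReducedSystem (p j : ℕ) (R : Finset ℤ) : Prop where
  not_dvd : ∀ b ∈ R, ¬ (p : ℤ) ∣ b
  exists_modEq : ∀ x : ℤ, ¬ (p : ℤ) ∣ x → ∃ b ∈ R, b ≡ x [ZMOD (p : ℤ) ^ j]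
  eq_of_modEq : ∀ b ∈ R, ∀ c ∈ R, b ≡ c [ZMOD (p : ℤ) ^ j] → b = c

/-- Here the symmetric range fails: it contains both `1` and `-1`, which agree modulo 2. -/
theorem isReducedSystem_two_one : IsReducedSystem 2 1 {-1} := by
  refine ⟨by simp, fun x hx => ⟨-1, by simp, ?_⟩, by simp⟩
  rw [Int.modEq_iff_dvd]
  push_cast at hx ⊢
  omega

/-- The symmetric reduced residue system modulo `p ^ j`. -/
noncomputable def symmSystem (p j : ℕ) : Finset ℤ :=
  {b ∈ Finset.Icc (-((p ^ j / 2 : ℕ) : ℤ)) ((p ^ j / 2 : ℕ) : ℤ) | ¬ (p : ℤ) ∣ b}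

theorem isReducedSystem_symmSystem {p j : ℕ} (hp : p.Prime) (hj : 1 ≤ j) (h : p = 2 → 2 ≤ j) :
    IsReducedSystem p j (symmSystem p j) := by
  have hpj : 0 < p ^ j := pow_pos hp.pos j
  have hdvd : (p : ℤ) ∣ (p : ℤ) ^ j := dvd_pow_self _ (by omega)
  refine ⟨fun b hb => (Finset.mem_filter.mp hb).2, fun x hx => ?_, fun b hb c hc hbc => ?_⟩
  · have hmem : ∀ y : ℤ, y ≡ x [ZMOD (p : ℤ) ^ j] → ¬ (p : ℤ) ∣ y := fun y hy hpy =>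
      hx ((hy.of_dvd hdvd).dvd_iff.mp hpy)
    have h0 : 0 ≤ x % ((p ^ j : ℕ) : ℤ) := Int.emod_nonneg _ (by omega)
    have h1 : x % ((p ^ j : ℕ) : ℤ) < ((p ^ j : ℕ) : ℤ) := Int.emod_lt_of_pos _ (by omega)
    have h2 : x % ((p ^ j : ℕ) : ℤ) ≡ x [ZMOD (p : ℤ) ^ j] := by
      push_cast
      exact Int.mod_modEq _ _
    by_cases h3 : x % ((p ^ j : ℕ) : ℤ) ≤ ((p ^ j / 2 : ℕ) : ℤ)
    · refine ⟨_, Finset.mem_filter.mpr ⟨Finset.mem_Icc.mpr ⟨by omega, h3⟩, hmem _ h2⟩, h2⟩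
    · have h4 : x % ((p ^ j : ℕ) : ℤ) - ((p ^ j : ℕ) : ℤ) ≡ x [ZMOD (p : ℤ) ^ j] := by
        refine Int.ModEq.trans ?_ h2
        rw [Int.modEq_iff_dvd]
        push_cast
        simp
      refine ⟨_, Finset.mem_filter.mpr ⟨Finset.mem_Icc.mpr ⟨by omega, by omega⟩, hmem _ h4⟩, h4⟩
  · obtain ⟨hb1, hb2⟩ := Finset.mem_filter.mp hb
    obtain ⟨hc1, hc2⟩ := Finset.mem_filter.mp hc
    rw [Finset.mem_Icc] at hb1 hc1
    obtain ⟨d, hd⟩ := hbc.dvd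
    rw [← Nat.cast_pow] at hd
    -- Only the endpoints `±p^j/2` could be distinct and congruent. That forces `p = 2`, and then
    -- `2^(j-1)` is even because `j ≥ 2`.
    have hodd : ∀ a : ℤ, ¬ (p : ℤ) ∣ a → 2 * a ≠ ((p ^ j : ℕ) : ℤ) := by
      intro a ha ha'
      have h2 : 2 ∣ p ^ j := by
        have : (2 : ℤ) ∣ ((p ^ j : ℕ) : ℤ) := ⟨a, ha'.symm⟩
        exact_mod_cast this
      have hp2 : p = 2 := ((Nat.prime_dvd_prime_iff_eq Nat.prime_two hp).mp
        (Nat.prime_two.dvd_of_dvd_pow h2)).symm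
      obtain ⟨i, rfl⟩ : ∃ i, j = i + 2 := ⟨j - 2, by have := h hp2; omega⟩
      subst hp2
      apply ha
      refine ⟨2 ^ i, ?_⟩
      push_cast at ha' ⊢
      rw [pow_add] at ha'
      linarith
    have h5 := hodd b hb2
    have h6 := hodd c hc2
    have h10 : c - b ≤ ((p ^ j : ℕ) : ℤ) := by omega
    have h11 : -((p ^ j : ℕ) : ℤ) ≤ c - b := by omega
    have h12 : (0 : ℤ) < ((p ^ j : ℕ) : ℤ) := by exact_mod_cast hpj
    have h7 : d < 2 := by nlinarith
    have h8 : -2 < d := by nlinarith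
    have h9 : d = -1 ∨ d = 0 ∨ d = 1 := by omega
    rcases h9 with rfl | rfl | rfl <;> omega

/-- Pairs `b` with `-b`; zero is a multiple of `p`, so the two halves are disjoint. -/
theorem prod_symmSystem {p j : ℕ} (hp : p.Prime) :
    ∏ b ∈ symmSystem p j, (X - C (b : ℚ)) =
      ∏ a ∈ Finset.Icc 0 (p ^ j / 2) with a.Coprime p, (X ^ 2 - C ((a : ℚ) ^ 2)) := by
  set S : Finset ℕ := {a ∈ Finset.Icc 0 (p ^ j / 2) | a.Coprime p} with hS
  have hmem : ∀ a, a ∈ S ↔ a ≤ p ^ j / 2 ∧ ¬ p ∣ a := by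
    intro a
    rw [hS, Finset.mem_filter, Finset.mem_Icc, Nat.coprime_comm, hp.coprime_iff_not_dvd]
    simp
  have hpos : ∀ a ∈ S, 0 < a := fun a ha =>
    Nat.pos_of_ne_zero fun h => ((hmem a).mp ha).2 (h ▸ dvd_zero p)
  have hR : symmSystem p j = S.image (fun a : ℕ => (a : ℤ)) ∪ S.image (fun a : ℕ => -(a : ℤ)) := by
    ext b
    simp only [symmSystem, Finset.mem_filter, Finset.mem_Icc, Finset.mem_union, Finset.mem_image,
      hmem]
    constructor
    · rintro ⟨⟨h1, h2⟩, h3⟩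
      rw [Int.natCast_dvd] at h3
      rcases le_total 0 b with hb | hb
      · exact Or.inl ⟨b.natAbs, ⟨by omega, h3⟩, by omega⟩
      · exact Or.inr ⟨b.natAbs, ⟨by omega, h3⟩, by omega⟩
    · rintro (⟨a, ⟨h1, h2⟩, rfl⟩ | ⟨a, ⟨h1, h2⟩, rfl⟩)
      · exact ⟨⟨by omega, by omega⟩, by rwa [Int.natCast_dvd_natCast]⟩
      · exact ⟨⟨by omega, by omega⟩, by rwa [dvd_neg, Int.natCast_dvd_natCast]⟩
  have hdisj : Disjoint (S.image (fun a : ℕ => (a : ℤ))) (S.image (fun a : ℕ => -(a : ℤ))) := by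
    rw [Finset.disjoint_left]
    intro b hb hb'
    obtain ⟨a, ha, rfl⟩ := Finset.mem_image.mp hb
    obtain ⟨c, hc, hac⟩ := Finset.mem_image.mp hb'
    have := hpos a ha
    omega
  rw [hR, Finset.prod_union hdisj, Finset.prod_image (by intro a _ b _ h; simpa using h),
    Finset.prod_image (by intro a _ b _ h; simpa using h), ← Finset.prod_mul_distrib]
  refine Finset.prod_congr rfl fun a _ => ?_
  simp only [Int.cast_neg, Int.cast_natCast, map_neg, map_pow]
  ring

theorem exists_isReducedSystem {p j : ℕ} (hp : p.Prime) (hj : 1 ≤ j) :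
    ∃ R, IsReducedSystem p j R ∧
      C ((p ^ j).factorial : ℚ) * digitPoly p j = ∏ b ∈ R, (X - C (b : ℚ)) := by
  have hfac : ∀ (n : ℕ) (Q : ℚ[X]), C (n.factorial : ℚ) * (C (1 / (n.factorial : ℚ)) * Q) = Q := by
    intro n Q
    have h : (n.factorial : ℚ) ≠ 0 := by exact_mod_cast n.factorial_ne_zero
    rw [← mul_assoc, ← C_mul, mul_one_div_cancel h, C_1, one_mul]
  match j, hj with
  | 1, _ =>
    by_cases h2 : p = 2
    · subst h2
      refine ⟨{-1}, isReducedSystem_two_one, ?_⟩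
      simp only [digitPoly, if_true, Finset.prod_singleton]
      rw [← mul_assoc, ← C_mul]
      norm_num [Nat.factorial]
    · refine ⟨symmSystem p 1, isReducedSystem_symmSystem hp le_rfl (fun h => absurd h h2), ?_⟩
      rw [prod_symmSystem hp]
      simp only [digitPoly, if_neg h2, pow_one]
      rw [hfac]
      refine Finset.prod_congr ?_ fun _ _ => rfl
      have hodd := hp.odd_of_ne_two h2
      have := hp.pos
      ext a
      rw [Finset.mem_filter, Finset.mem_Icc, Finset.mem_Icc, Nat.coprime_comm,
        hp.coprime_iff_not_dvd]
      obtain ⟨r, hr⟩ := hodd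
      constructor
      · rintro ⟨h1, h3⟩
        exact ⟨⟨by omega, by omega⟩, fun h => by have := Nat.le_of_dvd (by omega) h; omega⟩
      · rintro ⟨⟨_, h1⟩, h3⟩
        exact ⟨Nat.pos_of_ne_zero fun h => h3 (h ▸ dvd_zero p), by omega⟩
  | j + 2, _ =>
    exact ⟨symmSystem p (j + 2), isReducedSystem_symmSystem hp (by omega) (fun _ => by omega), by
      rw [prod_symmSystem hp, digitPoly, hfac]⟩

theorem IsReducedSystem.card_eq {p j : ℕ} {R : Finset ℤ} (hp : p.Prime) (hj : 1 ≤ j)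
    (hR : IsReducedSystem p j R) : R.card = (p ^ j).totient := by
  have : NeZero (p ^ j) := ⟨pow_ne_zero _ hp.ne_zero⟩
  have hunit : ∀ b : ℤ, IsUnit (b : ZMod (p ^ j)) ↔ ¬ (p : ℤ) ∣ b := by
    intro b
    rw [ZMod.coe_int_isUnit_iff_isCoprime, Nat.cast_pow, IsCoprime.pow_left_iff (by omega),
      (Nat.prime_iff_prime_int.mp hp).coprime_iff_not_dvd]
  rw [← ZMod.card_units_eq_totient, ← Finset.card_univ]
  refine Finset.card_bij (fun b hb => ((hunit b).mpr (hR.not_dvd b hb)).unit)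
    (fun _ _ => Finset.mem_univ _) (fun b hb c hc h => ?_) (fun u _ => ?_)
  · have h1 : (b : ZMod (p ^ j)) = c := by simpa using congrArg Units.val h
    rw [ZMod.intCast_eq_intCast_iff] at h1
    exact hR.eq_of_modEq b hb c hc (by exact_mod_cast h1)
  · obtain ⟨x, hx⟩ := ZMod.intCast_surjective (u : ZMod (p ^ j))
    obtain ⟨b, hb, hbx⟩ := hR.exists_modEq x ((hunit x).mp (hx ▸ u.isUnit))
    refine ⟨b, hb, Units.ext ?_⟩
    rw [IsUnit.unit_spec, ← hx, ZMod.intCast_eq_intCast_iff]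
    exact_mod_cast hbx

/-! ### Valuations of products over a reduced system -/

theorem exists_eq_pow_padicValInt_mul {p : ℕ} [Fact p.Prime] {r : ℤ} (hr : r ≠ 0) :
    ∃ u, ¬ (p : ℤ) ∣ u ∧ r = (p : ℤ) ^ padicValInt p r * u := by
  obtain ⟨u, hu⟩ := padicValInt_dvd (p := p) r
  refine ⟨u, fun ⟨w, hw⟩ => ?_, hu⟩
  have h : (p : ℤ) ^ (padicValInt p r + 1) ∣ r := ⟨w, by rw [pow_succ, mul_assoc, ← hw, ← hu]⟩
  rw [padicValInt_dvd_iff] at h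
  omega

theorem padicValInt_lt_of_not_dvd {p : ℕ} [Fact p.Prime] {j : ℕ} {r : ℤ}
    (hr : ¬ (p : ℤ) ^ j ∣ r) : padicValInt p r < j := by
  rw [padicValInt_dvd_iff] at hr
  omega

theorem padicValInt_eq_of_modEq {p : ℕ} [Fact p.Prime] {j : ℕ} {r s : ℤ}
    (hr : ¬ (p : ℤ) ^ j ∣ r) (hs : s ≡ r [ZMOD (p : ℤ) ^ j]) :
    padicValInt p s = padicValInt p r := by
  have hs' : ¬ (p : ℤ) ^ j ∣ s := fun h => hr (hs.dvd_iff.mp h)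
  have h : ∀ {a b : ℤ}, ¬ (p : ℤ) ^ j ∣ a → ¬ (p : ℤ) ^ j ∣ b → a ≡ b [ZMOD (p : ℤ) ^ j] →
      padicValInt p a ≤ padicValInt p b := by
    intro a b ha hb hab
    have h1 : (p : ℤ) ^ padicValInt p a ∣ b :=
      (hab.of_dvd (pow_dvd_pow _ (padicValInt_lt_of_not_dvd ha).le)).dvd_iff.mp (padicValInt_dvd a)
    rw [padicValInt_dvd_iff] at h1
    exact h1.resolve_left fun h => hb (h ▸ dvd_zero _)
  exact le_antisymm (h hs' hr hs) (h hr hs' hs.symm)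

/-- The sum of the valuations of the differences that do not vanish modulo `p ^ j`. -/
theorem IsReducedSystem.sum_padicValInt {p j : ℕ} [Fact p.Prime] {R : Finset ℤ}
    (hR : IsReducedSystem p j R) {x b₀ : ℤ} (hx : ¬ (p : ℤ) ∣ x) (hb₀ : b₀ ∈ R)
    (hb₀x : b₀ ≡ x [ZMOD (p : ℤ) ^ j]) :
    ∑ b ∈ R.erase b₀, padicValInt p (x - b) = padicValNat p (p ^ j - 1).factorial := by
  have hp : p.Prime := Fact.out
  have hpj : 0 < p ^ j := pow_pos hp.pos j
  have hpjZ : (0 : ℤ) < (p : ℤ) ^ j := by exact_mod_cast hpj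
  have hfac : ∀ n : ℕ, padicValNat p n.factorial = ∑ r ∈ Finset.Icc 1 n, padicValNat p r := by
    intro n
    induction n with
    | zero => simp
    | succ n ih =>
      rw [Nat.factorial_succ, padicValNat.mul (by omega) n.factorial_ne_zero, ih,
        Finset.sum_Icc_succ_top (by omega), add_comm]
  have hnd : ∀ b ∈ R.erase b₀, ¬ (p : ℤ) ^ j ∣ x - b := by
    intro b hb h
    obtain ⟨h1, h2⟩ := Finset.mem_erase.mp hb
    exact h1 (hR.eq_of_modEq b h2 b₀ hb₀ ((Int.modEq_iff_dvd.mpr h).trans hb₀x.symm))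
  have hcast : ∀ b : ℤ, ((((x - b) % (p : ℤ) ^ j).toNat : ℕ) : ℤ) = (x - b) % (p : ℤ) ^ j :=
    fun b => Int.toNat_of_nonneg (Int.emod_nonneg _ hpjZ.ne')
  rw [hfac]
  -- Only terms with nonzero valuation have to match. A multiple `r` of `p` is hit because `x - r`
  -- is again prime to `p`, hence represented in `R`.
  refine Finset.sum_bij_ne_zero (fun b _ _ => ((x - b) % (p : ℤ) ^ j).toNat) ?_ ?_ ?_ ?_
  · intro b hb _
    have h1 := hcast b
    have h2 := Int.emod_lt_of_pos (x - b) hpjZ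
    have h3 : (x - b) % (p : ℤ) ^ j ≠ 0 := fun h => hnd b hb (Int.dvd_of_emod_eq_zero h)
    have h4 : ((p ^ j : ℕ) : ℤ) = (p : ℤ) ^ j := by push_cast; rfl
    rw [Finset.mem_Icc]
    omega
  · intro b hb _ c hc _ h
    have h1 : (x - b) % (p : ℤ) ^ j = (x - c) % (p : ℤ) ^ j :=
      (hcast b).symm.trans ((congrArg _ h).trans (hcast c))
    have h2 : x - b ≡ x - c [ZMOD (p : ℤ) ^ j] := h1
    have h3 : b ≡ c [ZMOD (p : ℤ) ^ j] := by
      have := (Int.ModEq.refl x).sub h2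
      simpa using this
    exact hR.eq_of_modEq b (Finset.mem_of_mem_erase hb) c (Finset.mem_of_mem_erase hc) h3
  · intro r hr hr0
    rw [Finset.mem_Icc] at hr
    have hpr : (p : ℤ) ∣ r := by
      by_contra h
      exact hr0 (padicValNat.eq_zero_of_not_dvd fun h' => h (by exact_mod_cast h'))
    obtain ⟨b, hb, hbx⟩ := hR.exists_modEq (x - r) fun h => hx (by
      have := h.add hpr
      simpa using this)
    have h1 : x - b ≡ r [ZMOD (p : ℤ) ^ j] := by
      have := (Int.ModEq.refl x).sub hbx
      simpa using this
    have h2 : ((r : ℕ) : ℤ) % (p : ℤ) ^ j = r := by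
      refine Int.emod_eq_of_lt (by omega) ?_
      have : r < p ^ j := by omega
      exact_mod_cast this
    have h3 : (x - b) % (p : ℤ) ^ j = r := by rw [← h2]; exact h1
    have h4 : ¬ (p : ℤ) ^ j ∣ ((r : ℕ) : ℤ) := by
      intro h
      rw [Int.emod_eq_zero_of_dvd h] at h2
      omega
    refine ⟨b, Finset.mem_erase.mpr ⟨?_, hb⟩, ?_, by rw [h3]; simp⟩
    · rintro rfl
      have h5 := hb₀x.sub (Int.ModEq.refl b)
      rw [sub_self] at h5
      exact h4 (by simpa using (h5.trans h1).dvd)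
    · rw [padicValInt_eq_of_modEq h4 h1, padicValInt.of_nat]
      exact hr0
  · intro b hb _
    rw [← padicValInt.of_nat, hcast]
    exact (padicValInt_eq_of_modEq (hnd b hb) (Int.mod_modEq _ _)).symm ▸ rfl

/-- On the class modulo `p ^ j` of a unit, the product over a reduced system is
`p ^ ν_p((p ^ j)!)` times a function that is affine with unit slope modulo `p`. -/
theorem IsReducedSystem.prod_sub {p j : ℕ} [Fact p.Prime] {R : Finset ℤ}
    (hR : IsReducedSystem p j R) {x : ℤ} (hx : ¬ (p : ℤ) ∣ x) :
    ∃ b₀ u : ℤ, ¬ (p : ℤ) ∣ u ∧ ∀ y, y ≡ x [ZMOD (p : ℤ) ^ j] →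
      ∃ t u', y = b₀ + (p : ℤ) ^ j * t ∧ u' ≡ u [ZMOD p] ∧
        ∏ b ∈ R, (y - b) = (p : ℤ) ^ padicValNat p (p ^ j).factorial * (t * u') := by
  have hp : p.Prime := Fact.out
  have hpZ : Prime (p : ℤ) := Nat.prime_iff_prime_int.mp hp
  obtain ⟨b₀, hb₀, hb₀x⟩ := hR.exists_modEq x hx
  have hnd : ∀ b ∈ R.erase b₀, ¬ (p : ℤ) ^ j ∣ x - b := by
    intro b hb h
    obtain ⟨h1, h2⟩ := Finset.mem_erase.mp hb
    exact h1 (hR.eq_of_modEq b h2 b₀ hb₀ ((Int.modEq_iff_dvd.mpr h).trans hb₀x.symm))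
  have hu : ∀ b, ∃ u, b ∈ R.erase b₀ → ¬ (p : ℤ) ∣ u ∧
      x - b = (p : ℤ) ^ padicValInt p (x - b) * u := by
    intro b
    by_cases hb : b ∈ R.erase b₀
    · obtain ⟨u, hu⟩ := exists_eq_pow_padicValInt_mul (p := p) (r := x - b)
        fun h => hnd b hb (h ▸ dvd_zero _)
      exact ⟨u, fun _ => hu⟩
    · exact ⟨0, fun h => absurd h hb⟩
  choose u hu using hu
  refine ⟨b₀, ∏ b ∈ R.erase b₀, u b, fun h => ?_, fun y hy => ?_⟩
  · obtain ⟨b, hb, hpb⟩ := (hpZ.dvd_finsetProd_iff _).mp h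
    exact (hu b hb).1 hpb
  obtain ⟨t, ht⟩ := (hb₀x.trans hy.symm).dvd
  have hu' : ∀ b, ∃ v, b ∈ R.erase b₀ → v ≡ u b [ZMOD p] ∧
      y - b = (p : ℤ) ^ padicValInt p (x - b) * v := by
    intro b
    by_cases hb : b ∈ R.erase b₀
    · obtain ⟨s, hs⟩ := hy.symm.dvd
      have hlt := padicValInt_lt_of_not_dvd (hnd b hb)
      -- The valuation is strictly below `j`, so moving by a multiple of `p^j` changes the cofactor
      -- by a multiple of `p`.
      obtain ⟨d, hd⟩ : ∃ d, j = padicValInt p (x - b) + (d + 1) :=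
        ⟨j - padicValInt p (x - b) - 1, by omega⟩
      refine ⟨u b + (p : ℤ) ^ (d + 1) * s, fun _ => ⟨?_, ?_⟩⟩
      · rw [Int.modEq_iff_dvd, pow_succ]
        exact ⟨-((p : ℤ) ^ d * s), by ring⟩
      · have h1 : y - b = (x - b) + (p : ℤ) ^ j * s := by linarith
        have h2 : (p : ℤ) ^ j = (p : ℤ) ^ padicValInt p (x - b) * (p : ℤ) ^ (d + 1) := by
          rw [← pow_add, ← hd]
        linear_combination h1 + s * h2 + (hu b hb).2
    · exact ⟨0, fun h => absurd h hb⟩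
  choose v hv using hu'
  refine ⟨t, ∏ b ∈ R.erase b₀, v b, by linarith, ?_, ?_⟩
  · exact Int.ModEq.prod fun b hb => (hv b hb).1
  -- The factor `y - b₀ = p^j * t` supplies `j`; the remaining factors supply the valuation of `(p^j
  -- - 1)!`.
  · have hfac : padicValNat p (p ^ j).factorial = j + padicValNat p (p ^ j - 1).factorial := by
      have hpj : p ^ j ≠ 0 := pow_ne_zero _ hp.ne_zero
      rw [← Nat.mul_factorial_pred hpj, padicValNat.mul hpj (Nat.factorial_ne_zero _),
        padicValNat.prime_pow]
    rw [← Finset.mul_prod_erase R _ hb₀, Finset.prod_congr rfl fun b hb => (hv b hb).2,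
      Finset.prod_mul_distrib, Finset.prod_pow_eq_pow_sum, hR.sum_padicValInt hx hb₀ hb₀x, ht,
      hfac, pow_add]
    ring

/-! ### Digit polynomials and their normalised values -/

/-- An integral form `P` of `e_j` and its normalised values `q` on the integers prime to `p`. -/
structure IsDigitData (p j : ℕ) (P : ℤ[X]) (q : ℤ → ℤ) : Prop where
  map_eq : P.map (Int.castRingHom ℚ) = C ((p ^ j).factorial : ℚ) * digitPoly p j
  monic : P.Monic
  natDegree_eq : P.natDegree = (p ^ j).totient
  eval_eq : ∀ x : ℤ, ¬ (p : ℤ) ∣ x →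
    P.eval x = (p : ℤ) ^ padicValNat p (p ^ j).factorial * q x
  modEq : ∀ x y : ℤ, ¬ (p : ℤ) ∣ x → y ≡ x [ZMOD (p : ℤ) ^ (j + 1)] → q y ≡ q x [ZMOD p]
  modEq_of_modEq : 1 ≤ j → ∀ x y : ℤ, ¬ (p : ℤ) ∣ x → y ≡ x [ZMOD (p : ℤ) ^ j] →
    q y ≡ q x [ZMOD p] → y ≡ x [ZMOD (p : ℤ) ^ (j + 1)]

/-- For `j ≥ 1` both congruence properties come from one equivalence, `key`: on a class modulo `p^j`
the normalised value is `t` times a fixed unit modulo `p`, so it determines exactly `t` modulo `p`,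
that is, the class modulo `p^(j+1)`. -/
theorem exists_isDigitData (p j : ℕ) [Fact p.Prime] : ∃ P q, IsDigitData p j P q := by
  have hp : p.Prime := Fact.out
  have hpZ : Prime (p : ℤ) := Nat.prime_iff_prime_int.mp hp
  rcases Nat.eq_zero_or_pos j with rfl | hj
  · refine ⟨X, id, by simp [digitPoly], monic_X, by simp, fun x _ => by simp, fun x y _ h => ?_,
      fun h => absurd h (by omega)⟩
    simpa using h
  obtain ⟨R, hR, hRp⟩ := exists_isReducedSystem hp hj
  have heval : ∀ x : ℤ, (∏ b ∈ R, (X - C b)).eval x = ∏ b ∈ R, (x - b) := by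
    intro x
    rw [eval_prod]
    simp
  have hpow : (p : ℤ) ^ padicValNat p (p ^ j).factorial ≠ 0 := pow_ne_zero _ hpZ.ne_zero
  have key : ∀ x y : ℤ, ¬ (p : ℤ) ∣ x → y ≡ x [ZMOD (p : ℤ) ^ j] →
      ((∏ b ∈ R, (X - C b)).eval y / (p : ℤ) ^ padicValNat p (p ^ j).factorial ≡
        (∏ b ∈ R, (X - C b)).eval x / (p : ℤ) ^ padicValNat p (p ^ j).factorial [ZMOD p] ↔
      y ≡ x [ZMOD (p : ℤ) ^ (j + 1)]) := by
    intro x y hx hyx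
    obtain ⟨b₀, u, hu, h⟩ := hR.prod_sub hx
    obtain ⟨t, v, ht, hv, hy⟩ := h y hyx
    obtain ⟨s, w, hs, hw, hx'⟩ := h x rfl
    rw [heval, heval, hy, hx', Int.mul_ediv_cancel_left _ hpow, Int.mul_ediv_cancel_left _ hpow]
    have h1 : t * v ≡ s * w [ZMOD p] ↔ (p : ℤ) ∣ s - t := by
      have h2 : t * v ≡ t * u [ZMOD p] := hv.mul_left t
      have h3 : s * w ≡ s * u [ZMOD p] := hw.mul_left s
      have h4 : t * v ≡ s * w [ZMOD p] ↔ t * u ≡ s * u [ZMOD p] :=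
        ⟨fun h => (h2.symm.trans h).trans h3, fun h => (h2.trans h).trans h3.symm⟩
      rw [h4, Int.modEq_iff_dvd, ← sub_mul, hpZ.dvd_mul]
      exact or_iff_left hu
    rw [h1, Int.modEq_iff_dvd, hs, ht]
    have h5 : b₀ + (p : ℤ) ^ j * s - (b₀ + (p : ℤ) ^ j * t) = (p : ℤ) ^ j * (s - t) := by ring
    rw [h5, pow_succ]
    exact (mul_dvd_mul_iff_left (pow_ne_zero _ hpZ.ne_zero)).symm
  refine ⟨∏ b ∈ R, (X - C b),
    fun x => (∏ b ∈ R, (X - C b)).eval x / (p : ℤ) ^ padicValNat p (p ^ j).factorial, ?_,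
    monic_prod_X_sub_C _ _, ?_, fun x hx => ?_, fun x y hx h => ?_, fun _ x y hx h => ?_⟩
  · rw [hRp, Polynomial.map_prod]
    simp
  · rw [← hR.card_eq hp hj, natDegree_finsetProd_X_sub_C_eq_card]
  · obtain ⟨b₀, u, hu, h⟩ := hR.prod_sub hx
    obtain ⟨t, v, ht, hv, hy⟩ := h x rfl
    rw [heval, hy, Int.mul_ediv_cancel_left _ hpow]
  · exact (key x y hx (h.of_dvd (pow_dvd_pow _ (by omega)))).mpr h
  · exact (key x y hx h).mp

/-- The monic integral polynomial `(p ^ j)! * e_j`. -/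
noncomputable def digitIntPoly (p j : ℕ) [Fact p.Prime] : ℤ[X] :=
  (exists_isDigitData p j).choose

/-- The value of `digitIntPoly p j` divided by `p ^ ν_p((p ^ j)!)`. -/
noncomputable def digitVal (p j : ℕ) [Fact p.Prime] : ℤ → ℤ :=
  (exists_isDigitData p j).choose_spec.choose

theorem isDigitData (p j : ℕ) [Fact p.Prime] :
    IsDigitData p j (digitIntPoly p j) (digitVal p j) :=
  (exists_isDigitData p j).choose_spec.choose_spec

/-! ### The basis polynomials: integrality and parity -/

/-- The value of `E_n` up to a factor that is prime to `p`. -/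
noncomputable def basisVal (p n : ℕ) [Fact p.Prime] (x : ℤ) : ℤ :=
  ∏ j ∈ Finset.range (n + 1), digitVal p j x ^ phiDigit p n j

/-- The monic integral polynomial `C_p(k) * E_{2k}`. -/
noncomputable def basisIntPoly (p k : ℕ) [Fact p.Prime] : ℤ[X] :=
  ∏ j ∈ Finset.range (2 * k + 1), digitIntPoly p j ^ phiDigit p (2 * k) j

theorem basisIntPoly_map (p k : ℕ) [Fact p.Prime] :
    (basisIntPoly p k).map (Int.castRingHom ℚ)
      = C (leadDenom p k : ℚ) * basisPoly p (2 * k) := by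
  rw [basisIntPoly, Polynomial.map_prod, leadDenom, basisPoly, Nat.cast_prod, map_prod,
    ← Finset.prod_mul_distrib]
  refine Finset.prod_congr rfl fun j _ => ?_
  rw [Polynomial.map_pow, (isDigitData p j).map_eq, mul_pow, Nat.cast_pow, map_pow]

theorem basisIntPoly_monic (p k : ℕ) [Fact p.Prime] : (basisIntPoly p k).Monic :=
  monic_prod_of_monic _ _ fun j _ => (isDigitData p j).monic.pow _

theorem basisIntPoly_natDegree (p k : ℕ) [Fact p.Prime] :
    (basisIntPoly p k).natDegree = 2 * k := by
  have hp : p.Prime := Fact.out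
  rw [basisIntPoly, natDegree_prod_of_monic _ _ fun j _ => (isDigitData p j).monic.pow _]
  conv_rhs => rw [phiDigit_expansion hp (2 * k)]
  rw [Finset.sum_range_succ', add_comm]
  congr 1
  · rw [(isDigitData p 0).monic.natDegree_pow, (isDigitData p 0).natDegree_eq]
    simp
  · refine Finset.sum_congr rfl fun j _ => ?_
    rw [(isDigitData p _).monic.natDegree_pow, (isDigitData p _).natDegree_eq]

/-- Only `e_0`, and `e_1` when `p = 2`, fail to be polynomials in `X^2`. The digit `a_0` of `2k` is
even, as `p - 1` is even or equal to 1 (then `a_0 = 0`); for `p = 2` the digit `a_1` is the last bit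
of `2k`, hence 0. -/
theorem basisPoly_mem_range_expand {p : ℕ} (hp : p.Prime) (k : ℕ) :
    basisPoly p (2 * k) ∈ (expand ℚ 2).range := by
  have hX : (X : ℚ[X]) ^ 2 ∈ (expand ℚ 2).range := ⟨X, by simp⟩
  have hC : ∀ a : ℚ, C a ∈ (expand ℚ 2).range := fun a => ⟨C a, by simp⟩
  have hprod : ∀ (a : ℚ) (s : Finset ℕ),
      C a * ∏ b ∈ s, (X ^ 2 - C ((b : ℚ) ^ 2)) ∈ (expand ℚ 2).range := fun a s =>
    mul_mem (hC a) (prod_mem fun b _ => sub_mem hX (hC _))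
  refine prod_mem fun j _ => ?_
  match j with
  | 0 =>
    have h2 : Even (phiDigit p (2 * k) 0) := by
      simp only [phiDigit]
      rcases hp.eq_two_or_odd' with rfl | ⟨r, rfl⟩
      · simp [Nat.mod_one]
      · rw [Nat.add_sub_cancel, Nat.mul_mod_mul_left]
        exact even_two_mul _
    obtain ⟨r, hr⟩ := h2
    rw [hr, ← two_mul, pow_mul]
    exact pow_mem hX _
  | 1 =>
    by_cases h2 : p = 2
    · subst h2
      have : phiDigit 2 (2 * k) 1 = 0 := by simp [phiDigit]
      rw [this, pow_zero]
      exact one_mem _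
    · rw [digitPoly, if_neg h2]
      exact pow_mem (hprod _ _) _
  | j + 2 =>
    rw [digitPoly]
    exact pow_mem (hprod _ _) _

theorem basisIntPoly_coeff_odd (p k i : ℕ) [Fact p.Prime] (hi : ¬ 2 ∣ i) :
    (basisIntPoly p k).coeff i = 0 := by
  have hp : p.Prime := Fact.out
  obtain ⟨Q, hQ⟩ := basisPoly_mem_range_expand hp k
  have h : ((basisIntPoly p k).map (Int.castRingHom ℚ)).coeff i = 0 := by
    rw [basisIntPoly_map, coeff_C_mul, ← hQ]
    simp [coeff_expand, hi]
  rw [coeff_map, eq_intCast] at h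
  exact_mod_cast h

theorem basisIntPoly_coeff_even (p k i : ℕ) [Fact p.Prime] :
    (basisIntPoly p k).coeff (2 * i) = -recCoeff p k i := by
  have h := coe_recCoeff p k i
  rw [← basisIntPoly_map, coeff_map, eq_intCast] at h
  have h' : recCoeff p k i = -(basisIntPoly p k).coeff (2 * i) := by exact_mod_cast h
  rw [h', neg_neg]

/-- Stated over any commutative ring, to serve for integers and for `p`-adic units alike. -/
theorem aeval_basisIntPoly (p k : ℕ) [Fact p.Prime] {A : Type*} [CommRing A] (x : A) :
    aeval x (basisIntPoly p k)
      = x ^ (2 * k) - ∑ i ∈ Finset.range k, (recCoeff p k i : A) * x ^ (2 * i) := by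
  set H := basisIntPoly p k with hH
  have hQ : expand ℤ 2 (contract 2 H) = H := by
    ext i
    rw [coeff_expand two_pos]
    split_ifs with hi
    · rw [coeff_contract two_ne_zero, Nat.div_mul_cancel hi]
    · exact (basisIntPoly_coeff_odd p k i hi).symm
  have hdeg : (contract 2 H).natDegree < k + 1 := by
    rw [Nat.lt_succ_iff, natDegree_le_iff_coeff_eq_zero]
    intro i hi
    rw [coeff_contract two_ne_zero]
    exact coeff_eq_zero_of_natDegree_lt (by rw [hH, basisIntPoly_natDegree]; omega)
  have hlead : H.coeff (2 * k) = 1 := by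
    have := basisIntPoly_monic p k
    rwa [Monic, leadingCoeff, basisIntPoly_natDegree] at this
  rw [← hQ, expand_aeval, aeval_eq_sum_range' hdeg, Finset.sum_range_succ,
    coeff_contract two_ne_zero, mul_comm k 2, hlead, one_smul, ← pow_mul, add_comm, sub_eq_add_neg,
    ← Finset.sum_neg_distrib]
  congr 1
  refine Finset.sum_congr rfl fun i _ => ?_
  rw [coeff_contract two_ne_zero, mul_comm i 2, basisIntPoly_coeff_even, ← pow_mul, zsmul_eq_mul,
    Int.cast_neg, neg_mul]

/-- The `p`-part of each factor `(p^j)!` splits off on integers prime to `p`; this is the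
`p`-integrality of `E_{2k}` there. -/
theorem eval_basisIntPoly (p k : ℕ) [Fact p.Prime] {x : ℤ} (hx : ¬ (p : ℤ) ∣ x) :
    (basisIntPoly p k).eval x = localModulus p k * basisVal p (2 * k) x := by
  have hval : padicValNat p (leadDenom p k) = ∑ j ∈ Finset.range (2 * k + 1),
      padicValNat p (p ^ j).factorial * phiDigit p (2 * k) j := by
    rw [leadDenom]
    induction Finset.range (2 * k + 1) using Finset.induction_on with
    | empty => simp
    | insert j s hj ih =>
      rw [Finset.prod_insert hj, Finset.sum_insert hj, padicValNat.mul
        (pow_ne_zero _ (Nat.factorial_ne_zero _))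
        (Finset.prod_ne_zero_iff.mpr fun i _ => pow_ne_zero _ (Nat.factorial_ne_zero _)), ih,
        padicValNat.pow, mul_comm]
  rw [basisIntPoly, eval_prod, localModulus, hval, basisVal, Nat.cast_pow,
    ← Finset.prod_pow_eq_pow_sum, ← Finset.prod_mul_distrib]
  refine Finset.prod_congr rfl fun j _ => ?_
  rw [eval_pow, (isDigitData p j).eval_eq x hx, mul_pow, pow_mul]

/-! ### Linear independence modulo `p` -/

theorem sum_range_mul' {M : Type*} [AddCommMonoid M] (A B : ℕ) (f : ℕ → M) :
    ∑ n ∈ Finset.range (A * B), f n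
      = ∑ a ∈ Finset.range A, ∑ b ∈ Finset.range B, f (a * B + b) := by
  induction A with
  | zero => simp
  | succ A ih => rw [Nat.succ_mul, Finset.sum_range_add, ih, Finset.sum_range_succ]

theorem phiDigit_eq_zero_of_lt {p : ℕ} {n N j : ℕ} (hp : p.Prime) (hn : n < p ^ N * (p - 1))
    (hj : N < j) : phiDigit p n j = 0 := by
  obtain ⟨i, rfl⟩ : ∃ i, j = i + 1 := ⟨j - 1, by omega⟩
  have h1 : n / (p - 1) < p ^ N := by
    rw [Nat.div_lt_iff_lt_mul (Nat.sub_pos_of_lt hp.one_lt)]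
    exact hn
  have h2 : n / (p - 1) < p ^ i := h1.trans_le (Nat.pow_le_pow_right hp.pos (by omega))
  simp [phiDigit, Nat.div_eq_of_lt h2]

theorem basisVal_eq {p : ℕ} [Fact p.Prime] {n N : ℕ} (hn : n < p ^ N * (p - 1)) (x : ℤ) :
    basisVal p n x = ∏ j ∈ Finset.range (N + 1), digitVal p j x ^ phiDigit p n j := by
  have hp : p.Prime := Fact.out
  have h : ∀ A B : ℕ, A ≤ B → (∀ j, A ≤ j → phiDigit p n j = 0) →
      ∏ j ∈ Finset.range A, digitVal p j x ^ phiDigit p n j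
        = ∏ j ∈ Finset.range B, digitVal p j x ^ phiDigit p n j := by
    intro A B hAB hA
    refine Finset.prod_subset (Finset.range_subset_range.mpr hAB) fun j _ hj => ?_
    rw [hA j (by simpa using hj), pow_zero]
  rw [basisVal]
  rcases le_total n N with hnN | hnN
  · exact h _ _ (by omega) fun j hj => phiDigit_eq_zero hp (by omega)
  · exact (h _ _ (by omega) fun j hj => phiDigit_eq_zero_of_lt hp hn (by omega)).symm

/-- Since `p^N * (p - 1) = φ(p^(N+1))` is the place value of digit `N + 1`, adding `a` copies of it
sets this digit and leaves the lower ones alone. -/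
theorem basisVal_add {p : ℕ} [Fact p.Prime] {a b N : ℕ} (ha : a < p) (hb : b < p ^ N * (p - 1))
    (x : ℤ) :
    basisVal p (a * (p ^ N * (p - 1)) + b) x = digitVal p (N + 1) x ^ a * basisVal p b x := by
  have hp : p.Prime := Fact.out
  have hp1 : 0 < p - 1 := Nat.sub_pos_of_lt hp.one_lt
  have hn : a * (p ^ N * (p - 1)) + b < p ^ (N + 1) * (p - 1) := by
    calc a * (p ^ N * (p - 1)) + b < a * (p ^ N * (p - 1)) + p ^ N * (p - 1) := by omega
      _ = (a + 1) * (p ^ N * (p - 1)) := by ring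
      _ ≤ p * (p ^ N * (p - 1)) := Nat.mul_le_mul_right _ ha
      _ = p ^ (N + 1) * (p - 1) := by ring
  have hdiv : (a * (p ^ N * (p - 1)) + b) / (p - 1) = a * p ^ N + b / (p - 1) := by
    rw [← mul_assoc, add_comm, Nat.add_mul_div_right _ _ hp1, add_comm]
  have hlt : b / (p - 1) < p ^ N := by
    rw [Nat.div_lt_iff_lt_mul hp1]
    exact hb
  rw [basisVal_eq hn, basisVal_eq hb, Finset.prod_range_succ, mul_comm]
  congr 1
  · congr 1
    rw [phiDigit, hdiv, add_comm, Nat.add_mul_div_right _ _ (pow_pos hp.pos N),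
      Nat.div_eq_of_lt hlt, zero_add, Nat.mod_eq_of_lt ha]
  · refine Finset.prod_congr rfl fun j hj => ?_
    rw [Finset.mem_range] at hj
    congr 1
    match j with
    | 0 =>
      rw [phiDigit, phiDigit, ← mul_assoc, add_comm, Nat.add_mul_mod_self_right]
    | i + 1 =>
      obtain ⟨d, rfl⟩ : ∃ d, N = i + (d + 1) := ⟨N - i - 1, by omega⟩
      have h1 : a * p ^ (i + (d + 1)) = a * p ^ d * p * p ^ i := by ring
      rw [phiDigit, phiDigit, hdiv, h1, add_comm, Nat.add_mul_div_right _ _ (pow_pos hp.pos i),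
        Nat.add_mul_mod_self_right]

theorem basisVal_modEq {p : ℕ} [Fact p.Prime] {n N : ℕ} (hn : n < p ^ N * (p - 1)) {x y : ℤ}
    (hx : ¬ (p : ℤ) ∣ x) (hy : y ≡ x [ZMOD (p : ℤ) ^ (N + 1)]) :
    basisVal p n y ≡ basisVal p n x [ZMOD p] := by
  rw [basisVal_eq hn, basisVal_eq hn]
  refine Int.ModEq.prod fun j hj => Int.ModEq.pow _ ((isDigitData p j).modEq x y hx ?_)
  rw [Finset.mem_range] at hj
  exact hy.of_dvd (pow_dvd_pow _ (by omega))

/-- Vandermonde: a polynomial of degree below `N` with at least `N` roots is zero. -/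
theorem coeff_eq_zero_of_sum_mul_pow {K ι : Type*} [Field K] [Fintype ι] {f : ι → K}
    (hf : Function.Injective f) {N : ℕ} (hN : N ≤ Fintype.card ι) (c : ℕ → K)
    (h : ∀ i, ∑ a ∈ Finset.range N, c a * f i ^ a = 0) : ∀ a < N, c a = 0 := by
  intro a ha
  set P : K[X] := ∑ a ∈ Finset.range N, C (c a) * X ^ a with hP
  have hdeg : P.natDegree < Fintype.card ι := by
    refine lt_of_le_of_lt (natDegree_sum_le_of_forall_le (n := N - 1) _ _ fun b hb => ?_) (by omega)
    rw [Finset.mem_range] at hb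
    exact (natDegree_C_mul_X_pow_le _ _).trans (by omega)
  have h0 : P = 0 := by
    refine eq_zero_of_natDegree_lt_card_of_eval_eq_zero P hf (fun i => ?_) hdeg
    rw [hP, eval_finsetSum, ← h i]
    simp
  have h1 : P.coeff a = c a := by
    rw [hP, finsetSum_coeff]
    simp [coeff_X_pow, ha]
  rw [← h1, h0, coeff_zero]

/-- Induction on `N`. At the start only the powers `x^n`, `n < p - 1`, occur on the `p - 1` nonzero
residues. In the step write `n = a * B + b`. Along the `p` lifts `x + p^(N+1) * t` the values
`basisVal p b` are constant modulo `p`, while `digitVal p (N + 1)` takes `p` distinct values.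
Vandermonde then isolates each power `a` and leaves a relation of the previous level. -/
theorem basisVal_linearIndependent_aux (p : ℕ) [Fact p.Prime] (N : ℕ) (c : ℕ → ZMod p)
    (h : ∀ x : ℤ, ¬ (p : ℤ) ∣ x →
      ∑ n ∈ Finset.range (p ^ N * (p - 1)), c n * (basisVal p n x : ZMod p) = 0) :
    ∀ n < p ^ N * (p - 1), c n = 0 := by
  have hp : p.Prime := Fact.out
  have hp1 : 0 < p - 1 := Nat.sub_pos_of_lt hp.one_lt
  induction N generalizing c with
  | zero =>
    rw [pow_zero, one_mul] at h ⊢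
    have hcard : p - 1 ≤ Fintype.card (ZMod p)ˣ := by rw [ZMod.card_units]
    refine coeff_eq_zero_of_sum_mul_pow (f := fun u : (ZMod p)ˣ => (u : ZMod p))
      Units.val_injective hcard c fun u => ?_
    obtain ⟨x, hx⟩ := ZMod.intCast_surjective (u : ZMod p)
    have hpx : ¬ (p : ℤ) ∣ x := by
      rw [← ZMod.intCast_zmod_eq_zero_iff_dvd, hx]
      exact u.ne_zero
    rw [← h x hpx]
    refine Finset.sum_congr rfl fun n hn => ?_
    rw [Finset.mem_range] at hn
    have h0 : digitVal p 0 x = x := by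
      have h1 := (isDigitData p 0).eval_eq x hpx
      have h2 : digitIntPoly p 0 = X := by
        refine Polynomial.map_injective (Int.castRingHom ℚ) Int.cast_injective ?_
        rw [(isDigitData p 0).map_eq]
        simp [digitPoly]
      simpa [h2] using h1.symm
    rw [basisVal_eq (N := 0) (by simpa using hn)]
    simp [h0, hx, phiDigit, Nat.mod_eq_of_lt hn]
  | succ N ih =>
    set B := p ^ N * (p - 1) with hB
    have hpB : p ^ (N + 1) * (p - 1) = p * B := by rw [hB]; ring
    rw [hpB] at h ⊢
    have hBpos : 0 < B := Nat.mul_pos (pow_pos hp.pos N) hp1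
    have key : ∀ a < p, ∀ x : ℤ, ¬ (p : ℤ) ∣ x →
        ∑ b ∈ Finset.range B, c (a * B + b) * (basisVal p b x : ZMod p) = 0 := by
      intro a ha x hx
      have hmod : ∀ t : Fin p, x + (p : ℤ) ^ (N + 1) * (t : ℕ) ≡ x [ZMOD (p : ℤ) ^ (N + 1)] := by
        intro t
        rw [Int.modEq_iff_dvd]
        exact ⟨-(t : ℕ), by ring⟩
      have hdvd : (p : ℤ) ∣ (p : ℤ) ^ (N + 1) := dvd_pow_self _ (by omega)
      have hndvd : ∀ t : Fin p, ¬ (p : ℤ) ∣ x + (p : ℤ) ^ (N + 1) * (t : ℕ) := fun t hd =>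
        hx (((hmod t).of_dvd hdvd).dvd_iff.mp hd)
      refine coeff_eq_zero_of_sum_mul_pow (ι := Fin p) (N := p)
        (f := fun t => (digitVal p (N + 1) (x + (p : ℤ) ^ (N + 1) * (t : ℕ)) : ZMod p))
        (fun s t hst => ?_) (by simp)
        (fun a => ∑ b ∈ Finset.range B, c (a * B + b) * (basisVal p b x : ZMod p))
        (fun t => ?_) a ha
      · have h1 := (ZMod.intCast_eq_intCast_iff _ _ _).mp hst
        have h2 := (isDigitData p (N + 1)).modEq_of_modEq (by omega) _ _ (hndvd t)
          ((hmod s).trans (hmod t).symm) h1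
        have h3 := (Int.ModEq.add_left_cancel' x h2).dvd
        rw [← mul_sub, pow_succ (p : ℤ) (N + 1),
          mul_dvd_mul_iff_left (by exact_mod_cast pow_ne_zero _ hp.ne_zero)] at h3
        have h4 : ((s : ℕ) : ℤ) ≡ (t : ℕ) [ZMOD p] := Int.modEq_iff_dvd.mpr h3
        rw [Int.natCast_modEq_iff] at h4
        exact Fin.ext (Nat.ModEq.eq_of_lt_of_lt h4 s.2 t.2)
      · rw [← h _ (hndvd t), sum_range_mul']
        refine Finset.sum_congr rfl fun a ha => ?_
        rw [Finset.sum_mul]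
        refine Finset.sum_congr rfl fun b hb => ?_
        rw [Finset.mem_range] at ha hb
        have h5 : (basisVal p b (x + (p : ℤ) ^ (N + 1) * (t : ℕ)) : ZMod p) = basisVal p b x := by
          rw [ZMod.intCast_eq_intCast_iff]
          exact basisVal_modEq hb hx (hmod t)
        rw [basisVal_add ha hb, Int.cast_mul, h5, Int.cast_pow]
        ring
    intro n hn
    have h1 := ih (fun b => c (n / B * B + b))
      (key _ ((Nat.div_lt_iff_lt_mul hBpos).mpr hn)) (n % B) (Nat.mod_lt _ hBpos)
    rwa [mul_comm, Nat.div_add_mod] at h1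

/-- Modulo `p`, the functions `basisVal p n` on the integers prime to `p` are linearly
independent. -/
theorem basisVal_linearIndependent (p : ℕ) [Fact p.Prime] (N : ℕ) (c : ℕ → ZMod p)
    (h : ∀ x : ℤ, ¬ (p : ℤ) ∣ x →
      ∑ n ∈ Finset.range N, c n * (basisVal p n x : ZMod p) = 0) :
    ∀ n < N, c n = 0 := by
  have hp : p.Prime := Fact.out
  intro n hn
  have hN : N ≤ p ^ N * (p - 1) := (Nat.lt_pow_self hp.one_lt).le.trans
    (Nat.le_mul_of_pos_right _ (Nat.sub_pos_of_lt hp.one_lt))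
  have h1 := basisVal_linearIndependent_aux p N (fun n => if n < N then c n else 0)
    (fun x hx => ?_) n (hn.trans_le hN)
  · simpa [hn] using h1
  · refine Eq.trans (Eq.symm ?_) (h x hx)
    refine Finset.sum_subset_zero_on_sdiff (Finset.range_subset_range.mpr hN) (fun n hn => ?_)
      (fun n hn => ?_)
    · have : ¬ n < N := by simpa using (Finset.mem_sdiff.mp hn).2
      simp [this]
    · rw [if_pos (Finset.mem_range.mp hn)]

/-! ### Moments of measures satisfy the congruences -/

/-- The pointwise quotient is continuous because multiplication by `p^V` is a closed embedding of
the compact space `ℤ_p`. -/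
theorem exists_eq_pow_smul {p : ℕ} [Fact p.Prime] {Y : Type*} [TopologicalSpace Y] {V : ℕ}
    {f : C(Y, ℤ_[p])} (hf : ∀ y, (p : ℤ_[p]) ^ V ∣ f y) :
    ∃ g : C(Y, ℤ_[p]), f = (p : ℤ_[p]) ^ V • g := by
  have hp : p.Prime := Fact.out
  choose g hg using hf
  have hne : (p : ℤ_[p]) ^ V ≠ 0 := pow_ne_zero _ (by exact_mod_cast hp.ne_zero)
  have hemb : Topology.IsClosedEmbedding fun z : ℤ_[p] => (p : ℤ_[p]) ^ V * z :=
    (continuous_const_mul _).isClosedEmbedding (mul_right_injective₀ hne)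
  refine ⟨⟨g, hemb.isInducing.continuous_iff.mpr ?_⟩, ContinuousMap.ext fun y => ?_⟩
  · exact f.continuous.congr hg
  · simpa using hg y

theorem pow_dvd_aeval_basisIntPoly {p : ℕ} [Fact p.Prime] (k : ℕ) (u : ℤ_[p]ˣ) :
    (p : ℤ_[p]) ^ padicValNat p (leadDenom p k) ∣ aeval (u : ℤ_[p]) (basisIntPoly p k) := by
  set V := padicValNat p (leadDenom p k)
  -- Precision `V + 1` rather than `V`, so that `n` is prime to `p` even when `V = 0`.
  obtain ⟨n, hn⟩ : ∃ n : ℤ, (p : ℤ_[p]) ^ (V + 1) ∣ (u : ℤ_[p]) - n := by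
    have := PadicInt.appr_spec (V + 1) (u : ℤ_[p])
    rw [Ideal.mem_span_singleton] at this
    exact ⟨((u : ℤ_[p]).appr (V + 1) : ℕ), by rwa [Int.cast_natCast]⟩
  have hpn : ¬ (p : ℤ) ∣ n := by
    rintro ⟨d, rfl⟩
    have h1 : (p : ℤ_[p]) ∣ u := by
      have h2 := (dvd_pow_self (p : ℤ_[p]) V.succ_ne_zero).trans hn
      rw [Int.cast_mul, Int.cast_natCast] at h2
      have h3 := h2.add (dvd_mul_right (p : ℤ_[p]) d)
      rwa [sub_add_cancel] at h3
    exact PadicInt.prime_p.not_isUnit (isUnit_of_dvd_unit h1 u.isUnit)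
  have h1 : (p : ℤ_[p]) ^ V ∣ aeval (u : ℤ_[p]) (basisIntPoly p k)
      - aeval (n : ℤ_[p]) (basisIntPoly p k) := by
    refine ((pow_dvd_pow _ V.le_succ).trans hn).trans ?_
    rw [← eval_map_algebraMap, ← eval_map_algebraMap]
    exact sub_dvd_eval_sub _ _ _
  have h2 : aeval (n : ℤ_[p]) (basisIntPoly p k) = ((basisIntPoly p k).eval n : ℤ) := by
    have := aeval_algebraMap_apply_eq_algebraMap_eval (A := ℤ_[p]) n (basisIntPoly p k)
    simpa using this
  have h3 : (p : ℤ_[p]) ^ V ∣ aeval (n : ℤ_[p]) (basisIntPoly p k) := by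
    rw [h2, eval_basisIntPoly p k hpn, PadicInt.pow_p_dvd_int_iff, localModulus, Nat.cast_pow]
    exact dvd_mul_right _ _
  simpa using h1.add h3

/-- Integrates `x^(2m) * C_p(k) * E_{2k}(x)`, which is `p^V` times a continuous function. -/
theorem localModulus_dvd_of_moments {p : ℕ} [Fact p.Prime] {m : ℕ} {e : ℕ → ℤ} {μ : Meas p}
    (h : ∀ k, ((e k : ℤ) : ℤ_[p]) = μ (evenPow p (k + m))) (k : ℕ) :
    (localModulus p k : ℤ) ∣ e k - ∑ i ∈ Finset.range k, recCoeff p k i * e i := by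
  set V := padicValNat p (leadDenom p k)
  obtain ⟨g, hg⟩ := exists_eq_pow_smul (V := V) (f := evenPow p (k + m) -
    ∑ i ∈ Finset.range k, (recCoeff p k i : ℤ_[p]) • evenPow p (i + m)) fun y => by
      induction y using QuotientGroup.induction_on with
      | H u =>
        have h1 := (pow_dvd_aeval_basisIntPoly k u).mul_left ((u : ℤ_[p]) ^ (2 * m))
        rw [aeval_basisIntPoly] at h1
        convert h1 using 1
        simp only [ContinuousMap.sub_apply, ContinuousMap.sum_apply, ContinuousMap.smul_apply,
          evenPow_mk, smul_eq_mul]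
        rw [mul_sub, Finset.mul_sum, ← pow_add]
        congr 1
        · congr 1
          ring
        · refine Finset.sum_congr rfl fun i _ => ?_
          ring
  have h2 := congrArg μ hg
  rw [map_sub, map_sum, map_smul, ← h k] at h2
  simp only [map_smul, ← h, smul_eq_mul] at h2
  rw [localModulus, Nat.cast_pow, ← PadicInt.pow_p_dvd_int_iff]
  push_cast
  exact ⟨μ g, h2⟩

/-! ### Integers that satisfy the congruences are moments -/

/-- Duality: a nonzero functional vanishing on all these vectors would be a linear relation between
the functions `basisVal p (2 * k)`. -/
theorem span_basisVal_zmod_eq_top (p : ℕ) [Fact p.Prime] (K : ℕ) :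
    Submodule.span (ZMod p) (Set.range fun (x : {x : ℤ // ¬ (p : ℤ) ∣ x}) (k : Fin K) =>
      (basisVal p (2 * k) x : ZMod p)) = ⊤ := by
  by_contra hne
  obtain ⟨f, hf, hle⟩ := Submodule.exists_le_ker_of_lt_top _ (lt_top_iff_ne_top.mpr hne)
  apply hf
  set d : ℕ → ZMod p := fun k => if h : k < K then f (Pi.single ⟨k, h⟩ 1) else 0 with hd
  -- The relation involves even indices only; odd indices get coefficient 0.
  have hlin := basisVal_linearIndependent p (K * 2) (fun n => if 2 ∣ n then d (n / 2) else 0)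
    fun x hx => by
      have h1 : f (fun k : Fin K => (basisVal p (2 * k) x : ZMod p)) = 0 :=
        hle (Submodule.subset_span ⟨⟨x, hx⟩, rfl⟩)
      rw [LinearMap.pi_apply_eq_sum_univ] at h1
      refine Eq.trans ?_ h1
      rw [sum_range_mul', Finset.sum_range]
      refine Finset.sum_congr rfl fun k _ => ?_
      have h2 : ¬ 2 ∣ (k : ℕ) * 2 + 1 := by omega
      have h3 : d (k : ℕ) = f (Pi.single k 1) := by simp [hd]
      rw [Finset.sum_range_succ, Finset.sum_range_one, if_neg h2, if_pos (by omega), add_zero,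
        Nat.mul_div_cancel _ two_pos, h3, zero_mul, add_zero, mul_comm (k : ℕ) 2, smul_eq_mul,
        mul_comm]
      congr 2
      ext i
      simp [Pi.single_apply, eq_comm]
  refine LinearMap.pi_ext' fun k => LinearMap.ext_ring ?_
  have h1 := hlin (k * 2) (by omega)
  simpa [hd] using h1

/-- Nakayama's lemma over the local ring `ℤ_p`, with the coefficients of a relation modulo `p`
lifted by `ZMod.val`. -/
theorem span_basisVal_eq_top (p : ℕ) [Fact p.Prime] (K : ℕ) :
    Submodule.span ℤ_[p] (Set.range fun (x : {x : ℤ // ¬ (p : ℤ) ∣ x}) (k : Fin K) =>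
      (basisVal p (2 * k) x : ℤ_[p])) = ⊤ := by
  rw [eq_top_iff]
  refine Submodule.le_of_le_smul_of_le_jacobson_bot (I := IsLocalRing.maximalIdeal ℤ_[p])
    (IsNoetherian.noetherian _) (IsLocalRing.jacobson_eq_maximalIdeal _ bot_ne_top).ge ?_
  intro v _
  have hv : (fun k => PadicInt.toZMod (v k)) ∈ Submodule.span (ZMod p) (Set.range
      fun (x : {x : ℤ // ¬ (p : ℤ) ∣ x}) (k : Fin K) => (basisVal p (2 * k) x : ZMod p)) := by
    rw [span_basisVal_zmod_eq_top]
    trivial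
  rw [Finsupp.mem_span_range_iff_exists_finsupp] at hv
  obtain ⟨c, hc⟩ := hv
  set s : Fin K → ℤ_[p] := c.sum fun x a k => (a.val : ℤ_[p]) * (basisVal p (2 * k) x : ℤ_[p])
    with hs
  have hsmem : s ∈ Submodule.span ℤ_[p] (Set.range fun (x : {x : ℤ // ¬ (p : ℤ) ∣ x})
      (k : Fin K) => (basisVal p (2 * k) x : ℤ_[p])) :=
    Submodule.sum_mem _ fun x _ => Submodule.smul_mem _ _ (Submodule.subset_span ⟨x, rfl⟩)
  have hdvd : ∀ k, ∃ w, v k - s k = (p : ℤ_[p]) * w := by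
    intro k
    have h1 : PadicInt.toZMod (v k - s k) = 0 := by
      have h2 := congrFun hc k
      rw [map_sub, ← h2, hs, sub_eq_zero, Finsupp.sum, Finsupp.sum, Finset.sum_apply,
        Finset.sum_apply, map_sum]
      refine Finset.sum_congr rfl fun x _ => ?_
      simp
    have h3 : v k - s k ∈ IsLocalRing.maximalIdeal ℤ_[p] := by
      rw [← PadicInt.ker_toZMod]
      exact h1
    rwa [PadicInt.maximalIdeal_eq_span_p, Ideal.mem_span_singleton] at h3
  choose w hw using hdvd
  have h4 : v = s + (p : ℤ_[p]) • w := by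
    ext1 k
    rw [Pi.add_apply, Pi.smul_apply, smul_eq_mul, ← hw, add_sub_cancel]
  rw [h4]
  refine Submodule.add_mem_sup hsmem (Submodule.smul_mem_smul ?_ trivial)
  rw [PadicInt.maximalIdeal_eq_span_p]
  exact Ideal.mem_span_singleton_self _

/-- The Dirac measure at the class of a unit. -/
noncomputable def dirac (p : ℕ) [Fact p.Prime] (u : ℤ_[p]ˣ) : Meas p where
  toFun f := f u
  map_add' _ _ := rfl
  map_smul' _ _ := rfl

/-- The quotients `v k` of the divisibilities are prescribed as integrals of `basisVal p (2 * k)`,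
using point masses at integers prime to `p`. The relation between `E_{2k}` and the even powers then
gives the moments recursively. -/
theorem exists_measure_of_dvd_of_lt {p : ℕ} [Fact p.Prime] (m : ℕ) {e : ℕ → ℤ}
    (h : ∀ k, (localModulus p k : ℤ) ∣ e k - ∑ i ∈ Finset.range k, recCoeff p k i * e i) (K : ℕ) :
    ∃ μ : Meas p, ∀ k < K, μ (evenPow p (k + m)) = ((e k : ℤ) : ℤ_[p]) := by
  choose v hv using h
  have hvmem : (fun k : Fin K => ((v k : ℤ) : ℤ_[p])) ∈ Submodule.span ℤ_[p] (Set.range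
      fun (x : {x : ℤ // ¬ (p : ℤ) ∣ x}) (k : Fin K) => (basisVal p (2 * k) x : ℤ_[p])) := by
    rw [span_basisVal_eq_top]
    trivial
  rw [Finsupp.mem_span_range_iff_exists_finsupp] at hvmem
  obtain ⟨c, hc⟩ := hvmem
  have hunit : ∀ x : {x : ℤ // ¬ (p : ℤ) ∣ x}, IsUnit ((x : ℤ) : ℤ_[p]) := by
    intro x
    rw [← IsLocalRing.notMem_maximalIdeal, PadicInt.maximalIdeal_eq_span_p,
      Ideal.mem_span_singleton]
    intro hd
    have := (PadicInt.pow_p_dvd_int_iff (p := p) 1 x).mp (by simpa using hd)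
    exact x.2 (by simpa using this)
  choose u hu using hunit
  -- The weight `x^(-2m)` cancels the shift by `m` in the moments.
  set μ : Meas p := ∑ x ∈ c.support,
    (c x * ((u x)⁻¹ : ℤ_[p]ˣ) ^ (2 * m) : ℤ_[p]) • dirac p (u x) with hμ
  have hmom : ∀ k, μ (evenPow p (k + m)) = ∑ x ∈ c.support, c x * ((x : ℤ) : ℤ_[p]) ^ (2 * k) := by
    intro k
    rw [hμ, LinearMap.sum_apply]
    refine Finset.sum_congr rfl fun x _ => ?_
    have h1 : dirac p (u x) (evenPow p (k + m)) = ((u x : ℤ_[p]ˣ) : ℤ_[p]) ^ (2 * (k + m)) :=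
      evenPow_mk _ _ _
    rw [LinearMap.smul_apply, h1, smul_eq_mul, mul_add, pow_add, ← hu x]
    have h2 : ((((u x)⁻¹ : ℤ_[p]ˣ) : ℤ_[p]) ^ (2 * m)) * ((u x : ℤ_[p]ˣ) : ℤ_[p]) ^ (2 * m) = 1 := by
      rw [← mul_pow, Units.inv_mul, one_pow]
    linear_combination (c x * ((u x : ℤ_[p]ˣ) : ℤ_[p]) ^ (2 * k)) * h2
  refine ⟨μ, fun k => ?_⟩
  induction k using Nat.strong_induction_on with
  | _ k ih =>
    intro hk
    have h1 : μ (evenPow p (k + m))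
        - ∑ i ∈ Finset.range k, (recCoeff p k i : ℤ_[p]) * μ (evenPow p (i + m))
        = (localModulus p k : ℤ_[p]) * ((v k : ℤ) : ℤ_[p]) := by
      have h2 : ∑ x ∈ c.support, c x * (basisVal p (2 * k) x : ℤ_[p]) = (v k : ℤ) := by
        have := congrFun hc ⟨k, hk⟩
        simpa [Finsupp.sum] using this
      have h3 : ∀ x : {x : ℤ // ¬ (p : ℤ) ∣ x}, ((x : ℤ) : ℤ_[p]) ^ (2 * k)
          - ∑ i ∈ Finset.range k, (recCoeff p k i : ℤ_[p]) * ((x : ℤ) : ℤ_[p]) ^ (2 * i)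
          = (localModulus p k : ℤ_[p]) * (basisVal p (2 * k) x : ℤ_[p]) := by
        intro x
        have h4 := aeval_basisIntPoly p k (x : ℤ)
        rw [coe_aeval_eq_eval, eval_basisIntPoly p k x.2] at h4
        have h5 := congrArg (Int.cast : ℤ → ℤ_[p]) h4
        push_cast at h5
        exact h5.symm
      simp only [hmom, Finset.mul_sum]
      rw [Finset.sum_comm, ← Finset.sum_sub_distrib, ← h2, Finset.mul_sum]
      refine Finset.sum_congr rfl fun x _ => ?_
      have h6 : ∑ i ∈ Finset.range k, (recCoeff p k i : ℤ_[p]) * (c x * ((x : ℤ) : ℤ_[p]) ^ (2 * i))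
          = c x * ∑ i ∈ Finset.range k, (recCoeff p k i : ℤ_[p]) * ((x : ℤ) : ℤ_[p]) ^ (2 * i) := by
        rw [Finset.mul_sum]
        exact Finset.sum_congr rfl fun i _ => by ring
      rw [h6]
      linear_combination c x * h3 x
    have h2 := congrArg (Int.cast : ℤ → ℤ_[p]) (hv k)
    push_cast at h2
    rw [← h2, Finset.sum_congr rfl fun i hi => by
      rw [ih i (Finset.mem_range.mp hi) ((Finset.mem_range.mp hi).trans hk)]] at h1
    exact sub_left_injective h1

/-- By Tychonoff all functions from `C(UnitsModSign p, ℤ_[p])` to `ℤ_p` form a compact space.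
Linearity and each moment condition are closed, so the decreasing nonempty sets `T K` have a common
point. -/
theorem exists_measure_of_dvd {p : ℕ} [Fact p.Prime] (m : ℕ) {e : ℕ → ℤ}
    (h : ∀ k, (localModulus p k : ℤ) ∣ e k - ∑ i ∈ Finset.range k, recCoeff p k i * e i) :
    ∃ μ : Meas p, ∀ k, ((e k : ℤ) : ℤ_[p]) = μ (evenPow p (k + m)) := by
  set T : ℕ → Set (C(UnitsModSign p, ℤ_[p]) → ℤ_[p]) := fun K =>
    {φ | (∀ f g, φ (f + g) = φ f + φ g) ∧ (∀ (a : ℤ_[p]) f, φ (a • f) = a * φ f) ∧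
      ∀ k < K, φ (evenPow p (k + m)) = ((e k : ℤ) : ℤ_[p])} with hT
  have hclosed : ∀ K, IsClosed (T K) := by
    intro K
    simp only [hT, Set.ofPred_and, Set.ofPred_forall]
    refine IsClosed.inter ?_ (IsClosed.inter ?_ ?_)
    · exact isClosed_iInter fun f => isClosed_iInter fun g => isClosed_eq (by fun_prop) (by fun_prop)
    · exact isClosed_iInter fun a => isClosed_iInter fun f => isClosed_eq (by fun_prop) (by fun_prop)
    · exact isClosed_iInter fun k => isClosed_iInter fun _ => isClosed_eq (by fun_prop) (by fun_prop)
  obtain ⟨φ, hφ⟩ := IsCompact.nonempty_iInter_of_sequence_nonempty_isCompact_isClosed T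
    (fun K φ hφ => ⟨hφ.1, hφ.2.1, fun k hk => hφ.2.2 k (hk.trans K.lt_succ_self)⟩)
    (fun K => by
      obtain ⟨μ, hμ⟩ := exists_measure_of_dvd_of_lt m h K
      exact ⟨μ, map_add μ, fun a f => map_smul μ a f, hμ⟩)
    (hclosed 0).isCompact hclosed
  rw [Set.mem_iInter] at hφ
  exact ⟨{ toFun := φ, map_add' := (hφ 0).1, map_smul' := (hφ 0).2.1 },
    fun k => ((hφ (k + 1)).2.2 k k.lt_succ_self).symm⟩

/-! ### The matrix -/

theorem modulus_pos (k : ℕ) : 0 < modulus k :=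
  Finset.prod_pos fun _ hp => pow_pos (Finset.mem_filter.mp hp).2.pos _

theorem mem_primeSet {p k : ℕ} : p ∈ primeSet k ↔ p < 2 * k + 2 ∧ p.Prime := by
  rw [primeSet, Finset.mem_filter, Finset.mem_range]

/-- If `p - 1 > 2k`, only the digit `a_0` can be nonzero, and its factor is `1! = 1`. So primes
outside `primeSet k` impose no condition in row `2k`. -/
theorem localModulus_eq_one {p k : ℕ} (hp : p.Prime) (h : p ∉ primeSet k) :
    localModulus p k = 1 := by
  have h1 : 2 * k + 2 ≤ p := by
    rw [mem_primeSet] at h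
    by_contra h'
    exact h ⟨by omega, hp⟩
  have h2 : leadDenom p k = 1 := by
    refine Finset.prod_eq_one fun i _ => ?_
    match i with
    | 0 => simp
    | i + 1 =>
      have : 2 * k / (p - 1) = 0 := Nat.div_eq_of_lt (by omega)
      simp [phiDigit, this]
  rw [localModulus, h2]
  simp

theorem evenEntry_eq_zero (m : ℕ) {k j : ℕ} (h : k < j) : evenEntry m k j = 0 := by
  rw [evenEntry]
  split_ifs <;> first | rfl | omega

theorem evenEntry_self (m k : ℕ) : evenEntry m k k = modulus k := by
  rw [evenEntry]
  simp only [lt_irrefl, if_false, if_true]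
  split_ifs with h1
  · subst h1
    have : primeSet 0 = ∅ := by
      ext p
      rw [mem_primeSet]
      simp only [Finset.notMem_empty, iff_false]
      rintro ⟨h, hp⟩
      have := hp.two_le
      omega
    simp [modulus, this]
  · rfl

/-- Below the diagonal this is the defining congruence. For `j ≥ k` all earlier entries of the
column vanish, and the diagonal entry is a multiple of the modulus. -/
theorem localModulus_dvd_evenEntry (m : ℕ) {p : ℕ} (hp : p.Prime) (k j : ℕ) :
    (localModulus p k : ℤ) ∣ (1 - (p : ℤ) ^ (2 * (k + m) - 1)) * evenEntry m k j
      - ∑ i ∈ Finset.range k,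
        recCoeff p k i * ((1 - (p : ℤ) ^ (2 * (i + m) - 1)) * evenEntry m i j) := by
  by_cases hpk : p ∈ primeSet k
  swap
  · rw [localModulus_eq_one hp hpk, Nat.cast_one]
    exact one_dvd _
  rcases lt_or_ge j k with hj | hj
  · have h1 := ((evenEntry_spec m hj).2.2 p hpk).symm.dvd
    rw [Fin.sum_univ_eq_sum_range
      (fun i => recCoeff p k i * (1 - (p : ℤ) ^ (2 * (i + m) - 1)) * evenEntry m i j) k] at h1
    simpa only [mul_assoc] using h1
  · have h1 : ∑ i ∈ Finset.range k,
        recCoeff p k i * ((1 - (p : ℤ) ^ (2 * (i + m) - 1)) * evenEntry m i j) = 0 := by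
      refine Finset.sum_eq_zero fun i hi => ?_
      rw [evenEntry_eq_zero m ((Finset.mem_range.mp hi).trans_le hj), mul_zero, mul_zero]
    rw [h1, sub_zero]
    rcases hj.eq_or_lt with rfl | hj
    · rw [evenEntry_self]
      refine Dvd.dvd.mul_left ?_ _
      exact_mod_cast Finset.dvd_prod_of_mem (fun p => localModulus p k) hpk
    · rw [evenEntry_eq_zero m hj, mul_zero]
      exact dvd_zero _

/-- The value of the row `2 * k` of the matrix at the sequence `l`. -/
noncomputable def rowSum (m : ℕ) (l : ℕ → ℤ) (k : ℕ) : ℤ :=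
  ∑ j ∈ Finset.range (k + 1), evenEntry m k j * l j

theorem rowSum_eq_sum_range (m : ℕ) (l : ℕ → ℤ) {k N : ℕ} (h : k < N) :
    rowSum m l k = ∑ j ∈ Finset.range N, evenEntry m k j * l j := by
  refine Finset.sum_subset (Finset.range_subset_range.mpr h) fun j _ hj => ?_
  rw [evenEntry_eq_zero m (by simpa using hj), zero_mul]

theorem localModulus_dvd_rowSum (m : ℕ) (l : ℕ → ℤ) {p : ℕ} (hp : p.Prime) (k : ℕ) :
    (localModulus p k : ℤ) ∣ (1 - (p : ℤ) ^ (2 * (k + m) - 1)) * rowSum m l k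
      - ∑ i ∈ Finset.range k,
        recCoeff p k i * ((1 - (p : ℤ) ^ (2 * (i + m) - 1)) * rowSum m l i) := by
  have h : ∀ A : ℕ → ℤ, A k * rowSum m l k
      - ∑ i ∈ Finset.range k, recCoeff p k i * (A i * rowSum m l i)
      = ∑ j ∈ Finset.range (k + 1), (A k * evenEntry m k j
        - ∑ i ∈ Finset.range k, recCoeff p k i * (A i * evenEntry m i j)) * l j := by
    intro A
    simp only [sub_mul, Finset.sum_sub_distrib, Finset.sum_mul]
    rw [Finset.sum_comm]
    congr 1
    · rw [rowSum, Finset.mul_sum]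
      exact Finset.sum_congr rfl fun j _ => by ring
    · refine Finset.sum_congr rfl fun i hi => ?_
      rw [rowSum_eq_sum_range m l ((Finset.mem_range.mp hi).trans k.lt_succ_self), Finset.mul_sum,
        Finset.mul_sum]
      exact Finset.sum_congr rfl fun j _ => by ring
  rw [h fun k => 1 - (p : ℤ) ^ (2 * (k + m) - 1)]
  exact Finset.dvd_sum fun j _ => (localModulus_dvd_evenEntry m hp k j).mul_right _

theorem momentMap_even (m : ℕ) (l : ℕ → ℤ) (k : ℕ) (h : 2 * m ≤ 2 * (k + m)) :
    momentMap m l ⟨2 * (k + m), h⟩ = rowSum m l k := by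
  have h1 : 2 * (k + m) - 2 * m = 2 * k := by omega
  rw [momentMap, rowSum_eq_sum_range m l (show k < 2 * k + 1 by omega)]
  simp only [h1]
  refine Finset.sum_congr rfl fun j _ => ?_
  rw [momentMatrix, if_pos (even_two_mul k), Nat.mul_div_cancel_left _ two_pos]

theorem momentMap_odd (m : ℕ) (l : ℕ → ℤ) (k : {k : ℕ // 2 * m ≤ k}) (hk : Odd (k : ℕ)) :
    momentMap m l k = 0 := by
  have h1 : ¬ Even ((k : ℕ) - 2 * m) := by
    rw [Nat.even_sub k.2]
    simp [Nat.not_even_iff_odd.mpr hk]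
  refine Finset.sum_eq_zero fun j _ => ?_
  rw [momentMatrix, if_neg h1, zero_mul]

theorem momentMap_add (m : ℕ) (l l' : ℕ → ℤ) :
    momentMap m (l + l') = momentMap m l + momentMap m l' := by
  funext k
  simp only [momentMap, Pi.add_apply, mul_add, Finset.sum_add_distrib]

/-! ### Moment sequences as solutions of a triangular system -/

/-- Membership in `MomEuler m` in terms of congruences. -/
theorem mem_MomEuler_iff {m : ℕ} {b : {k : ℕ // 2 * m ≤ k} → ℤ} :
    b ∈ MomEuler m ↔ (∀ k : {k : ℕ // 2 * m ≤ k}, Odd (k : ℕ) → b k = 0) ∧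
      ∀ p : ℕ, p.Prime → ∀ k, (localModulus p k : ℤ) ∣
        (1 - (p : ℤ) ^ (2 * (k + m) - 1)) * b ⟨2 * (k + m), by omega⟩
          - ∑ i ∈ Finset.range k, recCoeff p k i *
            ((1 - (p : ℤ) ^ (2 * (i + m) - 1)) * b ⟨2 * (i + m), by omega⟩) := by
  refine and_congr_right fun _ => ⟨fun h p hp k => ?_, fun h p hp => ?_⟩
  · have : Fact p.Prime := ⟨hp⟩
    obtain ⟨μ, hμ⟩ := h p
    exact localModulus_dvd_of_moments (e := fun k =>
      (1 - (p : ℤ) ^ (2 * (k + m) - 1)) * b ⟨2 * (k + m), by omega⟩)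
      (fun k => hμ (k + m) (by omega)) k
  · obtain ⟨μ, hμ⟩ := exists_measure_of_dvd m (h p hp.out)
    refine ⟨μ, fun k hk => ?_⟩
    obtain ⟨i, rfl⟩ : ∃ i, k = i + m := ⟨k - m, by omega⟩
    exact hμ i

theorem momentMap_mem (m : ℕ) (l : ℕ → ℤ) : momentMap m l ∈ MomEuler m := by
  refine mem_MomEuler_iff.mpr ⟨momentMap_odd m l, fun p hp k => ?_⟩
  simp only [momentMap_even]
  exact localModulus_dvd_rowSum m l hp k

theorem eq_zero_of_rowSum_eq_zero {m : ℕ} {l : ℕ → ℤ} (h : ∀ k, rowSum m l k = 0) (k : ℕ) :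
    l k = 0 := by
  induction k using Nat.strong_induction_on with
  | _ k ih =>
    have h1 := h k
    rw [rowSum, Finset.sum_range_succ, Finset.sum_eq_zero fun j hj => by
      rw [ih j (Finset.mem_range.mp hj), mul_zero], zero_add, evenEntry_self] at h1
    exact (mul_eq_zero.mp h1).resolve_left (by exact_mod_cast (modulus_pos k).ne')

/-- Both `0` and the remainder of `x` solve the homogeneous system in `[0, M_k)`, so they coincide
by `existsUnique_entry`. -/
theorem modulus_dvd {m k : ℕ} {x : ℤ} (h : ∀ p ∈ primeSet k,
    (localModulus p k : ℤ) ∣ (1 - (p : ℤ) ^ (2 * (k + m) - 1)) * x) : (modulus k : ℤ) ∣ x := by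
  rcases Nat.eq_zero_or_pos k with rfl | hk
  -- For `k = 0` the modulus is 1, read off from the corner entry of the matrix.
  · have h1 := evenEntry_self 0 0
    rw [evenEntry, dif_pos rfl, if_pos rfl] at h1
    rw [← h1]
    exact one_dvd x
  obtain ⟨y, -, hy⟩ := existsUnique_entry m hk.ne' fun _ => 0
  have hM : (0 : ℤ) < modulus k := by exact_mod_cast modulus_pos k
  have h0 := hy 0 ⟨le_rfl, hM, fun p _ => by rw [mul_zero]⟩
  have h1 := hy (x % modulus k) ⟨Int.emod_nonneg _ hM.ne', Int.emod_lt_of_pos _ hM, fun p hp => by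
    have h2 : x % modulus k ≡ x [ZMOD localModulus p k] := (Int.mod_modEq _ _).of_dvd (by
      exact_mod_cast Finset.dvd_prod_of_mem (fun p => localModulus p k) hp)
    exact (h2.mul_left _).trans (Int.modEq_zero_iff_dvd.mpr (h p hp))⟩
  exact Int.dvd_of_emod_eq_zero (h1.trans h0.symm)

/-- The solution of the triangular system with right-hand side `B`. -/
noncomputable def solveRows (m : ℕ) (B : ℕ → ℤ) (k : ℕ) : ℤ :=
  (B k - ∑ j : Fin k, evenEntry m k j * solveRows m B j) / modulus k
termination_by k

/-- `B` and the row sums satisfy the same congruences and agree before `k`. Subtracting these leaves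
only the terms at `k`, so `modulus_dvd` makes the division in `solveRows` exact. -/
theorem rowSum_solveRows {m : ℕ} {B : ℕ → ℤ} (h : ∀ p : ℕ, p.Prime → ∀ k,
    (localModulus p k : ℤ) ∣ (1 - (p : ℤ) ^ (2 * (k + m) - 1)) * B k
      - ∑ i ∈ Finset.range k, recCoeff p k i * ((1 - (p : ℤ) ^ (2 * (i + m) - 1)) * B i))
    (k : ℕ) : rowSum m (solveRows m B) k = B k := by
  induction k using Nat.strong_induction_on with
  | _ k ih =>
    have hrow : rowSum m (solveRows m B) k = ∑ j ∈ Finset.range k,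
        evenEntry m k j * solveRows m B j + modulus k * solveRows m B k := by
      rw [rowSum, Finset.sum_range_succ, evenEntry_self]
    have hdvd : (modulus k : ℤ) ∣ B k - ∑ j ∈ Finset.range k, evenEntry m k j * solveRows m B j := by
      refine modulus_dvd (m := m) fun p hp => ?_
      have hp' := (mem_primeSet.mp hp).2
      have h1 := (h p hp' k).sub (localModulus_dvd_rowSum m (solveRows m B) hp' k)
      have hsum : ∑ i ∈ Finset.range k, recCoeff p k i *
            ((1 - (p : ℤ) ^ (2 * (i + m) - 1)) * rowSum m (solveRows m B) i)
          = ∑ i ∈ Finset.range k, recCoeff p k i * ((1 - (p : ℤ) ^ (2 * (i + m) - 1)) * B i) :=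
        Finset.sum_congr rfl fun i hi => by rw [ih i (Finset.mem_range.mp hi)]
      rw [hsum, hrow, sub_sub_sub_cancel_right] at h1
      have h2 : (localModulus p k : ℤ) ∣ modulus k := by
        exact_mod_cast Finset.dvd_prod_of_mem (fun p => localModulus p k) hp
      have h3 := h1.add (h2.mul_left ((1 - (p : ℤ) ^ (2 * (k + m) - 1)) * solveRows m B k))
      obtain ⟨d, hd⟩ := h3
      exact ⟨d, by linear_combination hd⟩
    have hsol : solveRows m B k
        = (B k - ∑ j ∈ Finset.range k, evenEntry m k j * solveRows m B j) / modulus k := by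
      conv_lhs => rw [solveRows]
      rw [Fin.sum_univ_eq_sum_range (fun j => evenEntry m k j * solveRows m B j) k]
    rw [hrow, hsol, Int.mul_ediv_cancel' hdvd]
    ring

end EulerMoments

theorem mainTheorem6 (m : ℕ) (hm : 1 ≤ m) :
    ∃ Φ : (ℕ → ℤ) ≃+ EulerMoments.MomEuler m,
      ∀ l : ℕ → ℤ, (Φ l : {k : ℕ // 2 * m ≤ k} → ℤ) = EulerMoments.momentMap m l := by
  let F : (ℕ → ℤ) →+ EulerMoments.MomEuler m := AddMonoidHom.mk'
    (fun l => ⟨EulerMoments.momentMap m l, EulerMoments.momentMap_mem m l⟩)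
    (fun l l' => Subtype.ext (EulerMoments.momentMap_add m l l'))
  refine ⟨AddEquiv.ofBijective F ⟨?_, ?_⟩, fun l => rfl⟩
  · rw [injective_iff_map_eq_zero]
    intro l hl
    funext k
    refine EulerMoments.eq_zero_of_rowSum_eq_zero (m := m) (fun k => ?_) k
    rw [← EulerMoments.momentMap_even m l k (by omega)]
    exact congrFun (congrArg Subtype.val hl) _
  · rintro ⟨b, hb⟩
    obtain ⟨hodd, hdvd⟩ := EulerMoments.mem_MomEuler_iff.mp hb
    refine ⟨EulerMoments.solveRows m fun k => b ⟨2 * (k + m), by omega⟩, Subtype.ext ?_⟩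
    funext ⟨k, hk⟩
    rcases Nat.even_or_odd' k with ⟨i, rfl | rfl⟩
    · obtain ⟨i, rfl⟩ : ∃ j, i = j + m := ⟨i - m, by omega⟩
      exact (EulerMoments.momentMap_even m _ i hk).trans (EulerMoments.rowSum_solveRows hdvd i)
    · have h1 : Odd (2 * i + 1) := odd_two_mul_add_one i
      exact (EulerMoments.momentMap_odd m _ ⟨_, hk⟩ h1).trans (hodd ⟨_, hk⟩ h1).symm
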